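/- Let $M$ be a smooth finite-dimensional manifold without boundary, $g$ a smooth pseudo-Riemannian metric on $M$ (of any signature), and $J_+,J_-$ two complex structures on $M$ (smooth endomorphism fields of $TM$ with $J_\pm^2=-\mathrm{Id}$ and vanishing Nijenhuis tensor) compatible with $g$, i.e. $g(J_\pm X,J_\pm Y)=g(X,Y)$. Let $F^\pm(X,Y)=g(J_\pm X,Y)$ be the Kähler forms and $d^\pm=i(\bar\partial_{J_\pm}-\partial_{J_\pm})$, so that $d^\pm F^\pm(X,Y,Z)=-dF^\pm(J_\pm X,J_\pm Y,J_\pm Z)$. Suppose that $d^+F^+=-d^-F^-$. Let $[J_+,J_-]=J_+J_--J_-J_+$. Then there is a complex bivector field $\Pi$ on $M$, i.e. a section of $\Lambda^2(TM\otimes\mathbb C)$, determined by the endomorphism $A=[J_+,J_-]-iJ_+[J_+,J_-]$ of $TM\otimes\mathbb C$ and the complex bilinear extension of $g$ through $$\Pi\big(g(X,\cdot),g(Y,\cdot)\big)=g(AX,Y)\qquad\text{for all tangent vectors }X,Y,$$ and $\Pi$ is a $J_+$-holomorphic Poisson structure: $\Pi$ is smooth, of type $(2,0)$ with respect to $J_+$,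 a holomorphic section of $\Lambda^2T^{(1,0)}M$ (that is, $\bar\partial\Pi=0$), and its Schouten–Nijenhuis bracket $[\Pi,\Pi]$ vanishes. Moreover, at every point $x\in M$, $\Pi_x=0$ if and only if $[J_+,J_-]_x=0$. -/

import Mathlib

open scoped Manifold ContDiff
open VectorField Bundle

noncomputable section

namespace HolPoisson

variable {E : Type*} [NormedAddCommGroup E] [NormedSpace ℝ E] {M : Type*} [TopologicalSpace M]
  [ChartedSpace E M]

/-- The exterior derivative of a differential `k`-form on a manifold without boundary: at each
point, pull the form back by the inverse of the chart, differentiate it on the model space, and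
pull the result back by the chart. -/
def mextDeriv {k : ℕ} (α : ∀ x : M, TangentSpace 𝓘(ℝ, E) x [⋀^Fin k]→L[ℝ] ℝ) (x : M) :
    TangentSpace 𝓘(ℝ, E) x [⋀^Fin (k + 1)]→L[ℝ] ℝ :=
  (extDeriv
    (fun y : E => (α ((extChartAt 𝓘(ℝ, E) x).symm y)).compContinuousLinearMap
      (mfderiv 𝓘(ℝ, E) 𝓘(ℝ, E) (extChartAt 𝓘(ℝ, E) x).symm y))
    (extChartAt 𝓘(ℝ, E) x x)).compContinuousLinearMap
      (mfderiv 𝓘(ℝ, E) 𝓘(ℝ, E) (extChartAt 𝓘(ℝ, E) x) x)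

variable [IsManifold 𝓘(ℝ, E) ∞ M]

/-- The vector field `X` is smooth around the point `x`. -/
def SmoothFieldAt (X : ∀ x : M, TangentSpace 𝓘(ℝ, E) x) (x : M) : Prop :=
  ContMDiffAt 𝓘(ℝ, E) 𝓘(ℝ, E).tangent ∞ (fun y => (⟨y, X y⟩ : TangentBundle 𝓘(ℝ, E) M)) x

variable (E M) in
/-- A smooth pseudo-Riemannian metric (of arbitrary signature). -/
structure PseudoRiemannianMetric where
  val : ∀ x : M, TangentSpace 𝓘(ℝ, E) x →L[ℝ] TangentSpace 𝓘(ℝ, E) x →L[ℝ] ℝ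
  symm : ∀ x v w, val x v w = val x w v
  nondegenerate : ∀ x v, (∀ w, val x v w = 0) → v = 0
  smooth : ContMDiff 𝓘(ℝ, E) (𝓘(ℝ, E).prod 𝓘(ℝ, E →L[ℝ] E →L[ℝ] ℝ)) ∞
    (fun x => TotalSpace.mk' (E →L[ℝ] E →L[ℝ] ℝ) x (val x))

variable (E M) in
/-- A complex structure, given as an integrable almost complex structure: a smooth endomorphism
field `J` with `J² = -1` whose Nijenhuis tensor
`[JX, JY] - J[JX, Y] - J[X, JY] - [X, Y]` vanishes. -/
structure ComplexStructure where
  toFun : ∀ x : M, TangentSpace 𝓘(ℝ, E) x →L[ℝ] TangentSpace 𝓘(ℝ, E) x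
  sq : ∀ x v, toFun x (toFun x v) = -v
  smooth : ContMDiff 𝓘(ℝ, E) (𝓘(ℝ, E).prod 𝓘(ℝ, E →L[ℝ] E)) ∞
    (fun x => TotalSpace.mk' (E →L[ℝ] E) x (toFun x))
  integrable : ∀ (x : M) (X Y : ∀ y : M, TangentSpace 𝓘(ℝ, E) y),
    SmoothFieldAt X x → SmoothFieldAt Y x →
      mlieBracket 𝓘(ℝ, E) (fun y => toFun y (X y)) (fun y => toFun y (Y y)) x
        - toFun x (mlieBracket 𝓘(ℝ, E) (fun y => toFun y (X y)) Y x)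
        - toFun x (mlieBracket 𝓘(ℝ, E) X (fun y => toFun y (Y y)) x)
        - mlieBracket 𝓘(ℝ, E) X Y x = 0

/-- The metric `g` is `J`-Hermitian: `g(JX, JY) = g(X, Y)`. -/
def Compatible (g : PseudoRiemannianMetric E M) (J : ComplexStructure E M) : Prop :=
  ∀ (x : M) (v w : TangentSpace 𝓘(ℝ, E) x), g.val x (J.toFun x v) (J.toFun x w) = g.val x v w

/-- The Kähler form `F(X, Y) = g(JX, Y)` of a compatible pair. -/
def kahlerForm (g : PseudoRiemannianMetric E M) (J : ComplexStructure E M) (h : Compatible g J)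
    (x : M) : TangentSpace 𝓘(ℝ, E) x [⋀^Fin 2]→L[ℝ] ℝ where
  toFun v := g.val x (J.toFun x (v 0)) (v 1)
  map_update_add' v i a b := by
    fin_cases i <;> simp [Function.update]
  map_update_smul' v i c a := by
    fin_cases i <;> simp [Function.update]
  cont := by fun_prop
  map_eq_zero_of_eq' v i j hij hne := by
    have h01 : v 0 = v 1 := by
      fin_cases i <;> fin_cases j <;> simp_all
    have h1 := h x (J.toFun x (v 0)) (v 0)
    have h2 := g.symm x (v 0) (J.toFun x (v 0))
    simp only [J.sq, map_neg, neg_apply] at h1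
    rw [← h01]
    linarith

/-- The operator `d^c = J⁻¹ ∘ d ∘ J` on `k`-forms, where `J` acts on forms by
`(Jα)(X₁, …) = α(JX₁, …)` and `J⁻¹` acts by `(J⁻¹α)(X₁, …) = α(-JX₁, …)`. For a complex structure
`J` it is `i(∂̄ - ∂)`, and `(d^c F)(X, Y, Z) = -dF(JX, JY, JZ)` for the Kähler form `F`. -/
def dc (J : ComplexStructure E M) {k : ℕ}
    (α : ∀ x : M, TangentSpace 𝓘(ℝ, E) x [⋀^Fin k]→L[ℝ] ℝ) (x : M) :
    TangentSpace 𝓘(ℝ, E) x [⋀^Fin (k + 1)]→L[ℝ] ℝ :=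
  (mextDeriv (fun y => (α y).compContinuousLinearMap (J.toFun y)) x).compContinuousLinearMap
    (-J.toFun x)

variable (E M) in
/-- A field of complex bivectors: at each point an element of `Λ²(T_xM ⊗ ℂ)`, seen as an alternating
complex bilinear form on the complexified cotangent space `Hom_ℝ(T_xM, ℂ)`. -/
abbrev BivectorField : Type _ :=
  ∀ x : M, (TangentSpace 𝓘(ℝ, E) x →L[ℝ] ℂ) [⋀^Fin 2]→ₗ[ℂ] ℂ

/-- The complex function `f` is smooth around the point `x`. -/
def SmoothFunAt (E : Type*) [NormedAddCommGroup E] [NormedSpace ℝ E] {M : Type*}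
    [TopologicalSpace M] [ChartedSpace E M] (f : M → ℂ) (x : M) : Prop :=
  ContMDiffAt 𝓘(ℝ, E) 𝓘(ℝ, ℂ) ∞ f x

/-- The bracket `{f, h} = P(df, dh)` of complex functions defined by a bivector field `P`. -/
def bracket (P : BivectorField E M) (f h : M → ℂ) (x : M) : ℂ :=
  P x ![mvfderiv 𝓘(ℝ, E) f x, mvfderiv 𝓘(ℝ, E) h x]

/-- `P` is smooth: its values on differentials of smooth functions (in particular its coefficients
in local coordinates) are smooth. -/
def IsSmooth (P : BivectorField E M) : Prop :=
  ∀ (x : M) (f h : M → ℂ), SmoothFunAt E f x → SmoothFunAt E h x →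
    SmoothFunAt E (bracket P f h) x

/-- `P` is a Poisson bivector field, `[P, P] = 0` for the Schouten-Nijenhuis bracket. As
`[P, P](df, dh, dk)` is, up to a nonzero constant, the Jacobiator of the bracket of `P`, this is the
Jacobi identity for that bracket on germs of smooth complex functions. -/
def IsPoisson (P : BivectorField E M) : Prop :=
  ∀ (x : M) (f h k : M → ℂ), SmoothFunAt E f x → SmoothFunAt E h x → SmoothFunAt E k x →
    bracket P f (bracket P h k) x + bracket P h (bracket P k f) x
      + bracket P k (bracket P f h) x = 0

/-- `P` is of type `(2,0)`, i.e. a section of `Λ²T^{1,0}`: since `P` is alternating, this says that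
`P(α ∘ J, β) = i P(α, β)`, or that `P` annihilates the covectors of type `(0,1)`. -/
def IsTypeTwoZero (J : ComplexStructure E M) (P : BivectorField E M) : Prop :=
  ∀ (x : M) (α β : TangentSpace 𝓘(ℝ, E) x →L[ℝ] ℂ),
    P x ![α.comp (J.toFun x), β] = Complex.I * P x ![α, β]

/-- The derivative `W f` of the complex function `f` along the `(0,1)`-vector field `W = Y + i JY`;
every `(0,1)`-vector field has this form for a unique real vector field `Y`. -/
def derivZeroOne (J : ComplexStructure E M) (Y : ∀ x : M, TangentSpace 𝓘(ℝ, E) x) (f : M → ℂ)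
    (x : M) : ℂ :=
  mvfderiv 𝓘(ℝ, E) f x (Y x) + Complex.I * mvfderiv 𝓘(ℝ, E) f x (J.toFun x (Y x))

/-- `P` is a holomorphic section of `Λ²T^{1,0}`: it is smooth, of type `(2,0)`, and `∂̄P = 0`. The
Dolbeault operator of `Λ²T^{1,0}` is `∂̄_W P = (L_W P)^{(2,0)}` for `W` of type `(0,1)`, with
`L_W` the Lie derivative, so the last condition says that, at each point, the bivector `L_W P`
given by `(L_W P)(df, dh) = W(P(df, dh)) - P(d(Wf), dh) - P(df, d(Wh))`
vanishes on all pairs of covectors `df, dh` of type `(1,0)` at that point. -/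
def IsHolomorphic (J : ComplexStructure E M) (P : BivectorField E M) : Prop :=
  IsSmooth P ∧ IsTypeTwoZero J P ∧
    ∀ (x : M) (Y : ∀ y : M, TangentSpace 𝓘(ℝ, E) y) (f h : M → ℂ),
      SmoothFieldAt Y x → SmoothFunAt E f x → SmoothFunAt E h x →
      (mvfderiv 𝓘(ℝ, E) f x).comp (J.toFun x) = Complex.I • mvfderiv 𝓘(ℝ, E) f x →
      (mvfderiv 𝓘(ℝ, E) h x).comp (J.toFun x) = Complex.I • mvfderiv 𝓘(ℝ, E) h x →
        derivZeroOne J Y (bracket P f h) x - bracket P (derivZeroOne J Y f) h x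
          - bracket P f (derivZeroOne J Y h) x = 0

/-- The commutator `[J₁, J₂] = J₁J₂ - J₂J₁`. -/
def commutator (J₁ J₂ : ComplexStructure E M) (x : M) :
    TangentSpace 𝓘(ℝ, E) x →L[ℝ] TangentSpace 𝓘(ℝ, E) x :=
  (J₁.toFun x).comp (J₂.toFun x) - (J₂.toFun x).comp (J₁.toFun x)

/-- The complex covector `g(v, ·)` dual to the real tangent vector `v`. -/
def flat (g : PseudoRiemannianMetric E M) (x : M) (v : TangentSpace 𝓘(ℝ, E) x) :
    TangentSpace 𝓘(ℝ, E) x →L[ℝ] ℂ :=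
  Complex.ofRealCLM.comp (g.val x v)

/-- `P` is the bivector field determined by the complex endomorphism field
`A = [J₁, J₂] - i J₁[J₁, J₂]` and the metric: `P(g(v, ·), g(w, ·)) = g(Av, w)` with `g` extended
complex bilinearly. As `g` is nondegenerate, this fixes `P`. -/
def IsDeterminedBy (g : PseudoRiemannianMetric E M) (J₁ J₂ : ComplexStructure E M)
    (P : BivectorField E M) : Prop :=
  ∀ (x : M) (v w : TangentSpace 𝓘(ℝ, E) x),
    P x ![flat g x v, flat g x w] =
      (g.val x (commutator J₁ J₂ x v) w : ℂ)
        - Complex.I * (g.val x (J₁.toFun x (commutator J₁ J₂ x v)) w : ℂ)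

end HolPoisson

end

open scoped Manifold ContDiff
open VectorField Bundle

noncomputable section

/-! Write `J`, `S` for the two complex structures and `∇` for the Levi-Civita connection. Put `H =
dF(J·, J·, J·)/2`, with `F` the Kähler form of `J`. Integrability gives `g((∇_X J)Y, Z) = -H(X, Y,
JZ) - H(X, JY, Z)` (`IsHermitianJet.eq_torsion`): `J` is parallel for the Bismut connection `∇ +
g⁻¹H`. It also gives that `H` has no `(3,0)` or `(0,3)` part (`IsHermitianJet.torsion_mixed`). The
hypothesis on `d^c` says that the form attached to `S` is `-H`. So `S` is parallel for `∇ - g⁻¹H`,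
and the same `H` lacks `(3,0)` and `(0,3)` parts for `S` as well. Consequently `∇A`, for `A = C -
iJC` with `C = [J, S]`, is an explicit expression linear in `H` (`torsionForm`,
`IsBihermitianJet.bivecDeriv_eq`).

As `C` anticommutes with `J`, the endomorphism `A` kills `T^{1,0}` and takes values in it, whence
the type `(2,0)`. Since `∇` is torsion free, second derivatives drop out of the Jacobiator, which
becomes the cyclic sum of `g((∇_{Ax} A)y, z)`. If some argument is of type `(1,0)`, the sum reduces
to values of `H` on three `(1,0)` vectors, hence to zero. If all are of type `(0,1)`, then `A = 4iS
+ 2(JS + SJ)`, where `JS + SJ` preserves type, and the sum vanishes by the type conditions on `H`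
for both structures (`torsionForm_cyclic`). Similarly `∂̄P = 0` reduces to the vanishing of `H` on
`(0,3)` triples (`torsionForm_zeroOne`).

The identities are first order, so the connection is needed only as a Christoffel tensor at the
centre of a chart. The complexified tangent space is replaced by the space of complex covectors,
identified with it by `g`; a skew endomorphism `B` then acts by `α ↦ -α ∘ B`. The zero locus is
immediate: the real part of `P(g(v, ·), g(w, ·))` is `g(Cv, w)`, and `g` is nondegenerate. -/

namespace HolPoisson

/-! ### Complex linear algebra of `A` and of the torsion -/

section ComplexAlgebra

variable {W : Type*} [AddCommGroup W] [Module ℂ W]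

/-- The pairing `⟨(∇_X C) y, z⟩` of the covariant derivative of the commutator `C = [J, S]`,
expressed through the torsion `H`. -/
def torsionReal (J S : W →ₗ[ℂ] W) (H : W →ₗ[ℂ] W →ₗ[ℂ] W →ₗ[ℂ] ℂ) (X y z : W) : ℂ :=
  -2 * H X (S y) (J z) - 2 * H X (J y) (S z) - H X (J (S y) + S (J y)) z
    - H X y (J (S z) + S (J z))

/-- The pairing `⟨(∇_X JC) y, z⟩` of the covariant derivative of `JC = J[J, S]`,
expressed through the torsion `H`. -/
def torsionImag (J S : W →ₗ[ℂ] W) (H : W →ₗ[ℂ] W →ₗ[ℂ] W →ₗ[ℂ] ℂ) (X y z : W) : ℂ :=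
  2 * H X (S (J y)) (J z) + 2 * H X (J y) (S (J z)) + H X (J (S (J y))) z + H X y (J (S (J z)))
    - H X (S y) z - H X y (S z)

/-- The pairing `⟨(∇_X A) y, z⟩` of the covariant derivative of `A = [J, S] - i J[J, S]`. -/
def torsionForm (J S : W →ₗ[ℂ] W) (H : W →ₗ[ℂ] W →ₗ[ℂ] W →ₗ[ℂ] ℂ) (X y z : W) : ℂ :=
  torsionReal J S H X y z - Complex.I * torsionImag J S H X y z

/-- The endomorphism `A = [J, S] - i J[J, S]`. -/
def poissonEnd (J S : W →ₗ[ℂ] W) : W →ₗ[ℂ] W :=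
  (J ∘ₗ S - S ∘ₗ J) - Complex.I • (J ∘ₗ (J ∘ₗ S - S ∘ₗ J))

variable {J S : W →ₗ[ℂ] W} {H : W →ₗ[ℂ] W →ₗ[ℂ] W →ₗ[ℂ] ℂ}

theorem poissonEnd_apply (hJ : ∀ x, J (J x) = -x) (x : W) :
    poissonEnd J S x = J (S x) - S (J x) + Complex.I • S x + Complex.I • J (S (J x)) := by
  simp only [poissonEnd, LinearMap.sub_apply, LinearMap.smul_apply, LinearMap.comp_apply, map_sub,
    hJ, smul_sub, smul_neg]
  abel

theorem map_poissonEnd (hJ : ∀ x, J (J x) = -x) (x : W) :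
    J (poissonEnd J S x) = Complex.I • poissonEnd J S x := by
  simp only [poissonEnd_apply hJ, map_sub, map_add, map_smul, hJ, smul_add, smul_sub, smul_smul,
    Complex.I_mul_I]
  module

/-- The commutator anticommutes with `J`, so on the `i`-eigenspace `J[J, S]` acts as `-i[J, S]` and
the two parts of `A` cancel. -/
theorem poissonEnd_eq_zero (hJ : ∀ x, J (J x) = -x) {x : W} (hx : J x = Complex.I • x) :
    poissonEnd J S x = 0 := by
  rw [poissonEnd_apply hJ, hx]
  simp only [map_smul, smul_smul, Complex.I_mul_I]
  module

/-- A trilinear form without `(3,0)` and `(0,3)` parts with respect to `J`. -/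
def IsMixed (J : W →ₗ[ℂ] W) (H : W →ₗ[ℂ] W →ₗ[ℂ] W →ₗ[ℂ] ℂ) : Prop :=
  ∀ x y z, H (J x) (J y) z + H x (J y) (J z) + H (J x) y (J z) = H x y z

/-- On a `±i`-eigenspace each of the three terms on the left is `-H`, so `-3H = H`. -/
theorem IsMixed.eq_zero (h : IsMixed J H) {x y z : W} {c : ℂ} (hc : c * c = -1)
    (hx : J x = c • x) (hy : J y = c • y) (hz : J z = c • z) : H x y z = 0 := by
  have := h x y z
  rw [hx, hy, hz] at this
  simp only [map_smul, LinearMap.smul_apply, smul_eq_mul] at this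
  linear_combination (-1 / 4 : ℂ) * this + (3 / 4 : ℂ) * H x y z * hc

theorem torsionForm_skew (hH : ∀ x y z, H x y z = -H x z y) (X y z : W) :
    torsionForm J S H X y z = -torsionForm J S H X z y := by
  simp only [torsionForm, torsionReal, torsionImag]
  rw [hH X (S y) (J z), hH X (J y) (S z), hH X _ z, hH X y, hH X (S (J y)) (J z),
    hH X (J y) (S (J z)), hH X (J (S (J y))) z, hH X y (J (S (J z))), hH X (S y) z, hH X y (S z)]
  ring

/-- The image of `A` lies in the isotropic space `T^{1,0}`, which the Bismut connection `∇ + g⁻¹H`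
preserves. So the derivative of `A` for that connection pairs to zero with `z`, and the only part of
its difference from `∇A` that pairs nontrivially with `z` is `H(X, Ay, z)`. -/
theorem torsionForm_of_eq_smul (hJ : ∀ x, J (J x) = -x) (X y : W) {z : W}
    (hz : J z = Complex.I • z) :
    torsionForm J S H X y z = -H X (poissonEnd J S y) z := by
  simp only [torsionForm, torsionReal, torsionImag, poissonEnd_apply hJ, hz, map_smul, map_add,
    map_sub, LinearMap.add_apply, LinearMap.sub_apply, LinearMap.smul_apply, smul_eq_mul]
  linear_combination (-2 * H X (S (J y)) z - H X y (J (S z)) -2 * H X (J y) (S z)) * Complex.I_mul_I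

theorem torsionForm_add_right (X y z z' : W) :
    torsionForm J S H X y (z + z') = torsionForm J S H X y z + torsionForm J S H X y z' := by
  simp only [torsionForm, torsionReal, torsionImag, map_add, LinearMap.add_apply]
  ring

theorem torsionForm_add_left (X X' y z : W) :
    torsionForm J S H (X + X') y z = torsionForm J S H X y z + torsionForm J S H X' y z := by
  simp only [torsionForm, torsionReal, torsionImag, map_add, LinearMap.add_apply]
  ring

theorem torsionForm_smul_left (c : ℂ) (X y z : W) :
    torsionForm J S H (c • X) y z = c * torsionForm J S H X y z := by
  simp only [torsionForm, torsionReal, torsionImag, map_smul, map_add, LinearMap.add_apply,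
    LinearMap.smul_apply, smul_eq_mul]
  ring

theorem torsionForm_add_mid (X y y' z : W) :
    torsionForm J S H X (y + y') z = torsionForm J S H X y z + torsionForm J S H X y' z := by
  simp only [torsionForm, torsionReal, torsionImag, map_add, LinearMap.add_apply]
  ring

/-- On vectors of type `(0,1)` the form `torsionForm` is the derivation action of
`A - 2 (JS + SJ)` on `H`. -/
theorem torsionForm_of_eq_neg_smul (X : W) {y z : W}
    (hy : J y = -Complex.I • y) (hz : J z = -Complex.I • z) :
    torsionForm J S H X y z = 2 * (2 * Complex.I * (H X (S y) z + H X y (S z))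
      - H X (J (S y) + S (J y)) z - H X y (J (S z) + S (J z))) := by
  simp only [torsionForm, torsionReal, torsionImag, hy, hz, map_smul, map_add, map_neg, neg_smul,
    LinearMap.add_apply, LinearMap.smul_apply, LinearMap.neg_apply, smul_eq_mul]
  linear_combination (-2 * Complex.I * (H X (S y) z + H X y (S z)) + H X (J (S y)) z
    + H X y (J (S z))) * Complex.I_mul_I

theorem poissonEnd_of_eq_neg_smul (hJ : ∀ x, J (J x) = -x) {x : W}
    (hx : J x = -Complex.I • x) :
    poissonEnd J S x = (4 * Complex.I) • S x + (2 : ℂ) • (J (S x) + S (J x)) := by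
  rw [poissonEnd_apply hJ, hx]
  simp only [map_smul, smul_smul, mul_neg, Complex.I_mul_I]
  module

/-- Write `p = JS + SJ`, so that `A = 4iS + 2p` here. Expanding, the terms with two `p`'s are values
of `H` on `(0,1)` triples. The terms with one `S` and one `p` cancel in the cyclic sum. The terms
with two `S`'s add up, by the mixed type for `S`, to a multiple of `H(x, y, z)`, which is again of
type `(0,3)`. -/
theorem torsionForm_cyclic_of_eq_neg_smul (hJ : ∀ x, J (J x) = -x)
    (hH₁ : ∀ x y z, H x y z = -H x z y) (hH₂ : ∀ x y z, H x y z = -H y x z)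
    (hHJ : IsMixed J H) (hHS : IsMixed S H) {x y z : W} (hx : J x = -Complex.I • x)
    (hy : J y = -Complex.I • y) (hz : J z = -Complex.I • z) :
    torsionForm J S H (poissonEnd J S x) y z + torsionForm J S H (poissonEnd J S y) z x
      + torsionForm J S H (poissonEnd J S z) x y = 0 := by
  have hc : (-Complex.I) * (-Complex.I) = -1 := by simp
  -- `JS + SJ` commutes with `J`, hence preserves the `(0,1)` space.
  have hp : ∀ {x}, J x = -Complex.I • x →
      J (J (S x) + S (J x)) = -Complex.I • (J (S x) + S (J x)) := by
    intro x hx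
    rw [hx]
    simp only [map_add, map_smul, hJ, smul_add, smul_smul, neg_mul_neg, Complex.I_mul_I]
    module
  have cyc : ∀ u v w, H u v w = H v w u := fun u v w => by
    rw [hH₁ v w u, hH₂ v u w, neg_neg]
  have h₀ := hHJ.eq_zero hc hx hy hz
  have h₁ := hHJ.eq_zero hc (hp hx) (hp hy) hz
  have h₂ := hHJ.eq_zero hc hx (hp hy) (hp hz)
  have h₃ := hHJ.eq_zero hc (hp hx) hy (hp hz)
  have h₄ := hHS x y z
  rw [torsionForm_of_eq_neg_smul _ hy hz, torsionForm_of_eq_neg_smul _ hz hx,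
    torsionForm_of_eq_neg_smul _ hx hy, poissonEnd_of_eq_neg_smul hJ hx,
    poissonEnd_of_eq_neg_smul hJ hy, poissonEnd_of_eq_neg_smul hJ hz]
  generalize J (S x) + S (J x) = px at *
  generalize J (S y) + S (J y) = py at *
  generalize J (S z) + S (J z) = pz at *
  simp only [map_smul, map_add, LinearMap.add_apply, LinearMap.smul_apply, smul_eq_mul]
  -- Rotates the arguments of every `H` so that the three slots carry `x`, `y`, `z` in this order,
  -- whatever operators are applied to them.
  simp only [← cyc x, ← cyc (S x), ← cyc px, cyc (S z), cyc pz]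
  linear_combination 32 * Complex.I ^ 2 * (h₄ + h₀) - 8 * (h₁ + h₂ + h₃)

/-- The cyclic sum of `torsionForm (A x) y z` vanishes: the algebraic form of `[P, P] = 0`. -/
theorem torsionForm_cyclic (hJ : ∀ x, J (J x) = -x)
    (hH₁ : ∀ x y z, H x y z = -H x z y) (hH₂ : ∀ x y z, H x y z = -H y x z)
    (hHJ : IsMixed J H) (hHS : IsMixed S H) (x y z : W) :
    torsionForm J S H (poissonEnd J S x) y z + torsionForm J S H (poissonEnd J S y) z x
      + torsionForm J S H (poissonEnd J S z) x y = 0 := by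
  let T : W → W → W → ℂ := fun x y z => torsionForm J S H (poissonEnd J S x) y z
    + torsionForm J S H (poissonEnd J S y) z x + torsionForm J S H (poissonEnd J S z) x y
  have T_cyc : ∀ x y z, T x y z = T z x y := fun x y z => by simp only [T]; ring
  have T_add : ∀ x y z z', T x y (z + z') = T x y z + T x y z' := fun x y z z' => by
    simp only [T, map_add, torsionForm_add_left, torsionForm_add_mid, torsionForm_add_right]
    ring
  -- With `z` of type `(1,0)`, `Az = 0` and the other two terms are `±H(Ax, Ay, z)` up to order,
  -- with all entries of type `(1,0)`.
  have T_zero : ∀ x y z, J z = Complex.I • z → T x y z = 0 := by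
    intro x y z hz
    have h := hHJ.eq_zero Complex.I_mul_I (map_poissonEnd (S := S) hJ x)
      (map_poissonEnd (S := S) hJ y) hz
    have h0 : torsionForm J S H 0 x y = 0 := by simp [torsionForm, torsionReal, torsionImag]
    simp only [T]
    rw [poissonEnd_eq_zero hJ hz, h0, torsionForm_of_eq_smul hJ _ _ hz,
      torsionForm_skew hH₁ _ z x, torsionForm_of_eq_smul hJ _ _ hz,
      hH₂ (poissonEnd J S y), h]
    simp
  have decomp : ∀ x, ∃ a b, x = a + b ∧ J a = Complex.I • a ∧ J b = -Complex.I • b := by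
    intro x
    refine ⟨(1 / 2 : ℂ) • (x - Complex.I • J x), (1 / 2 : ℂ) • (x + Complex.I • J x), by module,
      ?_, ?_⟩
    · simp only [map_smul, map_sub, hJ, smul_sub, smul_smul, mul_left_comm Complex.I,
        Complex.I_mul_I]
      module
    · simp only [map_smul, map_add, hJ, smul_add, smul_smul, mul_left_comm (-Complex.I),
        neg_mul, Complex.I_mul_I]
      module
  obtain ⟨x₁, x₀, rfl, hx₁, hx₀⟩ := decomp x
  obtain ⟨y₁, y₀, rfl, hy₁, hy₀⟩ := decomp y
  obtain ⟨z₁, z₀, rfl, hz₁, hz₀⟩ := decomp z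
  change T (x₁ + x₀) (y₁ + y₀) (z₁ + z₀) = 0
  rw [T_add, T_zero _ _ _ hz₁, T_cyc, T_add, T_zero _ _ _ hy₁, T_cyc, T_add, T_zero _ _ _ hx₁,
    T_cyc]
  simpa [T] using torsionForm_cyclic_of_eq_neg_smul hJ hH₁ hH₂ hHJ hHS hx₀ hy₀ hz₀

/-- The algebraic form of `∂̄P = 0`. -/
theorem torsionForm_zeroOne (hJ : ∀ x, J (J x) = -x) (hHJ : IsMixed J H) {x y : W} (Y : W)
    (hx : J x = -Complex.I • x) (hy : J y = -Complex.I • y) :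
    torsionForm J S H (Y + Complex.I • J Y) x y
      - H (Y + Complex.I • J Y) (poissonEnd J S x) y
      - H (Y + Complex.I • J Y) x (poissonEnd J S y) = 0 := by
  have hc : (-Complex.I) * (-Complex.I) = -1 := by simp
  have hY : J (Y + Complex.I • J Y) = -Complex.I • (Y + Complex.I • J Y) := by
    simp only [map_add, map_smul, hJ, smul_add, smul_smul, neg_mul, Complex.I_mul_I]
    module
  have hp : ∀ {x}, J x = -Complex.I • x →
      J (J (S x) + S (J x)) = -Complex.I • (J (S x) + S (J x)) := by
    intro x hx
    rw [hx]
    simp only [map_add, map_smul, hJ, smul_add, smul_smul, neg_mul_neg, Complex.I_mul_I]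
    module
  rw [torsionForm_of_eq_neg_smul _ hx hy, poissonEnd_of_eq_neg_smul hJ hx,
    poissonEnd_of_eq_neg_smul hJ hy]
  simp only [map_smul, LinearMap.smul_apply, smul_eq_mul, map_add _ ((4 * Complex.I) • _),
    LinearMap.add_apply _ _ y,
    hHJ.eq_zero hc hY (hp hx) hy, hHJ.eq_zero hc hY hx (hp hy)]
  ring

end ComplexAlgebra

/-! ### The covariant derivative of `J` in terms of its torsion form -/

section Torsion

variable {V : Type*} [AddCommGroup V] [Module ℝ V]

/-- The cyclic sum `b(JX, JY, JZ) + b(JY, JZ, JX) + b(JZ, JX, JY)`, halved; for `b(X, Y, Z) = g((∇_X J) Y, Z)` it is the torsion `dF(JX, JY, JZ) / 2`. -/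
def torsion (J : V → V) (b : V → V → V → ℝ) (X Y Z : V) : ℝ :=
  (b (J X) (J Y) (J Z) + b (J Y) (J Z) (J X) + b (J Z) (J X) (J Y)) / 2

/-- The first order identities satisfied by `b(X, Y, Z) = g((∇_X J) Y, Z)` for an integrable
Hermitian structure `J`. -/
structure IsHermitianJet (J : V →ₗ[ℝ] V) (b : V →ₗ[ℝ] V →ₗ[ℝ] V →ₗ[ℝ] ℝ) : Prop where
  sq : ∀ x, J (J x) = -x
  skew : ∀ x y z, b x y z = -b x z y
  anti : ∀ x y z, b x (J y) z = b x y (J z)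
  nijenhuis : ∀ x y z, b (J x) y z - b (J y) x z + b x y (J z) - b y x (J z) = 0

variable {J : V →ₗ[ℝ] V} {b : V →ₗ[ℝ] V →ₗ[ℝ] V →ₗ[ℝ] ℝ}

theorem IsHermitianJet.skew' (h : IsHermitianJet J b) (x y z : V) :
    b x y (J z) = -b x z (J y) := by
  rw [h.skew, h.anti]

/-- This says that `J` is parallel for the metric connection `∇ + g⁻¹H`. It is the classical
expression of `∇J` by `dF`, whose correction term is the Nijenhuis tensor, here zero. -/
theorem IsHermitianJet.eq_torsion (h : IsHermitianJet J b) (x y z : V) :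
    b x y z = -torsion J (b · · ·) x y (J z) - torsion J (b · · ·) x (J y) z := by
  have h₁ := h.nijenhuis x y (J z)
  have h₂ := h.nijenhuis x z (J y)
  simp only [torsion, h.anti, h.sq, map_neg, LinearMap.neg_apply, neg_neg] at *
  linarith [h.skew' (J x) y z, h.skew' (J y) x z, h.skew' (J z) x y, h.skew x y z, h.skew y x z,
    h.skew z x y]

/-- For integrable `J`, the differential of the `(1,1)`-form `F` has type `(2,1) + (1,2)`. In terms
of `b` this is the sum of the Nijenhuis identities over cyclic permutations. -/
theorem IsHermitianJet.torsion_mixed (h : IsHermitianJet J b) (x y z : V) :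
    torsion J (b · · ·) (J x) (J y) z + torsion J (b · · ·) x (J y) (J z)
      + torsion J (b · · ·) (J x) y (J z) = torsion J (b · · ·) x y z := by
  have h₁ := h.nijenhuis x y z
  have h₂ := h.nijenhuis y z x
  have h₃ := h.nijenhuis z x y
  simp only [torsion, h.anti, h.sq, map_neg, LinearMap.neg_apply, neg_neg] at *
  linarith [h.skew' x y z, h.skew' y x z, h.skew' z x y, h.skew (J x) y z, h.skew (J y) x z,
    h.skew (J z) x y]

theorem IsHermitianJet.torsion_swap_right (h : IsHermitianJet J b) (x y z : V) :
    torsion J (b · · ·) x y z = -torsion J (b · · ·) x z y := by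
  simp only [torsion]
  linarith [h.skew (J x) (J y) (J z), h.skew (J y) (J z) (J x), h.skew (J z) (J x) (J y)]

theorem torsion_cyclic {V : Type*} (J : V → V) (b : V → V → V → ℝ) (x y z : V) :
    torsion J b x y z = torsion J b y z x := by
  simp only [torsion]
  ring

end Torsion

/-! ### Complex covectors as a model of the complexified tangent space -/

section Complexification

variable {E : Type*} [NormedAddCommGroup E] [NormedSpace ℝ E]
  {N : Type*} [AddCommGroup N] [Module ℝ N] [Module ℂ N] [IsScalarTower ℝ ℂ N]

/-- The complex covector `g(v, ·)`. -/
def cflat (g : E →L[ℝ] E →L[ℝ] ℝ) (v : E) : E →L[ℝ] ℂ := Complex.ofRealCLM.comp (g v)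

/-- The complex linear extension of a real linear map `l` to the complexification, the latter
being identified with the space of complex covectors by means of the isomorphism `s` from
covectors to vectors. -/
def extend (s : (E →L[ℝ] ℝ) →L[ℝ] E) : (E →ₗ[ℝ] N) →ₗ[ℝ] ((E →L[ℝ] ℂ) →ₗ[ℂ] N) where
  toFun l :=
    { toFun := fun w => l (s (Complex.reCLM.comp w)) + Complex.I • l (s (Complex.imCLM.comp w))
      map_add' := fun w w' => by
        simp only [ContinuousLinearMap.comp_add, map_add, smul_add]
        abel
      map_smul' := fun c w => by
        have h₁ : Complex.reCLM.comp (c • w)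
            = c.re • Complex.reCLM.comp w - c.im • Complex.imCLM.comp w := by
          ext; simp
        have h₂ : Complex.imCLM.comp (c • w)
            = c.re • Complex.imCLM.comp w + c.im • Complex.reCLM.comp w := by
          ext; simp
        have h₃ : ∀ (r : ℝ) (n : N), r • n = (r : ℂ) • n := fun r n =>
          (algebraMap_smul ℂ r n).symm
        have h₄ : ∀ n : N, Complex.I • Complex.I • n = -n := fun n => by
          rw [smul_smul, Complex.I_mul_I, neg_one_smul]
        conv_rhs => rw [← Complex.re_add_im c]
        simp only [h₁, h₂, map_add, map_sub, map_smul, h₃, RingHom.id_apply, smul_add, add_smul,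
          mul_smul, h₄]
        module }
  map_add' l l' := by
    ext w
    simp only [LinearMap.add_apply, LinearMap.coe_mk, AddHom.coe_mk, smul_add]
    abel
  map_smul' c l := by
    ext w
    simp only [LinearMap.smul_apply, LinearMap.coe_mk, AddHom.coe_mk, RingHom.id_apply, smul_add]
    rw [smul_comm c Complex.I]

theorem extend_apply (s : (E →L[ℝ] ℝ) →L[ℝ] E) (l : E →ₗ[ℝ] N) (w : E →L[ℝ] ℂ) :
    extend s l w = l (s (Complex.reCLM.comp w)) + Complex.I • l (s (Complex.imCLM.comp w)) := rfl

theorem extend_cflat {s : (E →L[ℝ] ℝ) →L[ℝ] E} {g : E →L[ℝ] E →L[ℝ] ℝ} (hsg : ∀ v, s (g v) = v)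
    (l : E →ₗ[ℝ] N) (v : E) : extend s l (cflat g v) = l v := by
  have h₁ : Complex.reCLM.comp (cflat g v) = g v := by ext; simp [cflat]
  have h₂ : Complex.imCLM.comp (cflat g v) = 0 := by ext; simp [cflat]
  rw [extend_apply, h₁, h₂, hsg, map_zero, map_zero, smul_zero, add_zero]

theorem eq_cflat_add {s : (E →L[ℝ] ℝ) →L[ℝ] E} {g : E →L[ℝ] E →L[ℝ] ℝ} (hgs : ∀ a, g (s a) = a)
    (w : E →L[ℝ] ℂ) :
    w = cflat g (s (Complex.reCLM.comp w)) + Complex.I • cflat g (s (Complex.imCLM.comp w)) := by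
  ext v
  simp [cflat, hgs, mul_comm Complex.I, Complex.re_add_im]

/-- The map `α ↦ -α ∘ B` on complex covectors, corresponding to `B` if `B` is skew. -/
def coAct (B : E →L[ℝ] E) : (E →L[ℝ] ℂ) →ₗ[ℂ] (E →L[ℝ] ℂ) where
  toFun α := -α.comp B
  map_add' α β := by rw [ContinuousLinearMap.add_comp, neg_add]
  map_smul' c α := by ext; simp

@[simp]
theorem coAct_apply (B : E →L[ℝ] E) (α : E →L[ℝ] ℂ) : coAct B α = -α.comp B := rfl

/-- The complex bilinear extension of the metric, on complex covectors. -/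
def pairing (s : (E →L[ℝ] ℝ) →L[ℝ] E) (w β : E →L[ℝ] ℂ) : ℂ :=
  β (s (Complex.reCLM.comp w)) + Complex.I * β (s (Complex.imCLM.comp w))

theorem pairing_eq_extend (s : (E →L[ℝ] ℝ) →L[ℝ] E) (w β : E →L[ℝ] ℂ) :
    pairing s w β = extend s (β : E →ₗ[ℝ] ℂ) w := rfl

theorem pairing_add_left (s : (E →L[ℝ] ℝ) →L[ℝ] E) (w w' β : E →L[ℝ] ℂ) :
    pairing s (w + w') β = pairing s w β + pairing s w' β := by
  simp only [pairing_eq_extend, map_add]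

theorem pairing_smul_left (s : (E →L[ℝ] ℝ) →L[ℝ] E) (c : ℂ) (w β : E →L[ℝ] ℂ) :
    pairing s (c • w) β = c * pairing s w β := by
  simp only [pairing_eq_extend, map_smul, smul_eq_mul]

theorem pairing_neg_left (s : (E →L[ℝ] ℝ) →L[ℝ] E) (w β : E →L[ℝ] ℂ) :
    pairing s (-w) β = -pairing s w β := by
  simp only [pairing_eq_extend, map_neg]

theorem pairing_add_right (s : (E →L[ℝ] ℝ) →L[ℝ] E) (w β β' : E →L[ℝ] ℂ) :
    pairing s w (β + β') = pairing s w β + pairing s w β' := by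
  simp only [pairing, _root_.add_apply]
  ring

theorem pairing_smul_right (s : (E →L[ℝ] ℝ) →L[ℝ] E) (c : ℂ) (w β : E →L[ℝ] ℂ) :
    pairing s w (c • β) = c * pairing s w β := by
  simp only [pairing, _root_.smul_apply, smul_eq_mul]
  ring

theorem pairing_neg_right (s : (E →L[ℝ] ℝ) →L[ℝ] E) (w β : E →L[ℝ] ℂ) :
    pairing s w (-β) = -pairing s w β := by
  simp only [pairing, _root_.neg_apply]
  ring

theorem pairing_cflat_left {s : (E →L[ℝ] ℝ) →L[ℝ] E} {g : E →L[ℝ] E →L[ℝ] ℝ}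
    (hsg : ∀ v, s (g v) = v) (v : E) (β : E →L[ℝ] ℂ) : pairing s (cflat g v) β = β v := by
  rw [pairing_eq_extend, extend_cflat hsg]
  rfl

/-- A bilinear map on complex covectors which vanishes on real vectors vanishes. -/
theorem bilinear_eq_zero {s : (E →L[ℝ] ℝ) →L[ℝ] E} {g : E →L[ℝ] E →L[ℝ] ℝ}
    (hgs : ∀ a, g (s a) = a) (T : (E →L[ℝ] ℂ) → (E →L[ℝ] ℂ) → ℂ)
    (h₁ : ∀ a b y, T (a + Complex.I • b) y = T a y + Complex.I * T b y)
    (h₂ : ∀ x a b, T x (a + Complex.I • b) = T x a + Complex.I * T x b)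
    (h : ∀ x y, T (cflat g x) (cflat g y) = 0) (x y : E →L[ℝ] ℂ) : T x y = 0 := by
  rw [eq_cflat_add hgs x, eq_cflat_add hgs y]
  simp only [h₁, h₂, h, mul_zero, add_zero]

theorem trilinear_eq_zero {s : (E →L[ℝ] ℝ) →L[ℝ] E} {g : E →L[ℝ] E →L[ℝ] ℝ}
    (hgs : ∀ a, g (s a) = a) (T : (E →L[ℝ] ℂ) → (E →L[ℝ] ℂ) → (E →L[ℝ] ℂ) → ℂ)
    (h₁ : ∀ a b y z, T (a + Complex.I • b) y z = T a y z + Complex.I * T b y z)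
    (h₂ : ∀ x a b z, T x (a + Complex.I • b) z = T x a z + Complex.I * T x b z)
    (h₃ : ∀ x y a b, T x y (a + Complex.I • b) = T x y a + Complex.I * T x y b)
    (h : ∀ x y z, T (cflat g x) (cflat g y) (cflat g z) = 0) (x y z : E →L[ℝ] ℂ) :
    T x y z = 0 := by
  rw [eq_cflat_add hgs x, eq_cflat_add hgs y, eq_cflat_add hgs z]
  simp only [h₁, h₂, h₃, h, mul_zero, add_zero]

theorem pairing_symm {s : (E →L[ℝ] ℝ) →L[ℝ] E} {g : E →L[ℝ] E →L[ℝ] ℝ}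
    (hgs : ∀ a, g (s a) = a) (hsg : ∀ v, s (g v) = v) (hg : ∀ v w, g v w = g w v)
    (α β : E →L[ℝ] ℂ) : pairing s α β = pairing s β α := by
  rw [← sub_eq_zero]
  refine bilinear_eq_zero hgs (fun α β => pairing s α β - pairing s β α) ?_ ?_ ?_ α β
  · intro a b y
    simp only [pairing_add_left, pairing_smul_left, pairing_add_right, pairing_smul_right]
    ring
  · intro a b y
    simp only [pairing_add_left, pairing_smul_left, pairing_add_right, pairing_smul_right]
    ring
  · intro x y
    simp only [pairing_cflat_left hsg]
    simp [cflat, hg x y]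

theorem pairing_comp {s : (E →L[ℝ] ℝ) →L[ℝ] E} {g : E →L[ℝ] E →L[ℝ] ℝ}
    (hgs : ∀ a, g (s a) = a) (hsg : ∀ v, s (g v) = v) (hg : ∀ v w, g v w = g w v)
    {B : E →L[ℝ] E} (hB : ∀ v w, g (B v) w = -g v (B w)) (α β : E →L[ℝ] ℂ) :
    pairing s (α.comp B) β = -pairing s α (β.comp B) := by
  rw [← sub_eq_zero]
  refine bilinear_eq_zero hgs (fun α β => pairing s (α.comp B) β - -pairing s α (β.comp B))
    ?_ ?_ ?_ α β
  · intro a b y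
    simp only [pairing_add_left, pairing_smul_left, ContinuousLinearMap.add_comp,
      ContinuousLinearMap.smul_comp]
    ring
  · intro a b y
    simp only [pairing_add_right, pairing_smul_right, ContinuousLinearMap.add_comp,
      ContinuousLinearMap.smul_comp]
    ring
  · intro x y
    rw [pairing_symm hgs hsg hg, pairing_cflat_left hsg, pairing_cflat_left hsg]
    simp only [cflat, ContinuousLinearMap.comp_apply, Complex.ofRealCLM_apply]
    rw [← hg (B y) x, hB, hg y]
    simp

end Complexification

/-! ### Pointwise identities for a bihermitian pair -/

section Jet

variable {E : Type*} [NormedAddCommGroup E] [NormedSpace ℝ E]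

/-- The complex trilinear extension of a real trilinear form. -/
def complexify (s : (E →L[ℝ] ℝ) →L[ℝ] E) (H : E →ₗ[ℝ] E →ₗ[ℝ] E →ₗ[ℝ] ℝ) :
    (E →L[ℝ] ℂ) →ₗ[ℂ] (E →L[ℝ] ℂ) →ₗ[ℂ] (E →L[ℝ] ℂ) →ₗ[ℂ] ℂ :=
  -- The values are first made complex; then the third, second and first arguments are extended in
  -- turn.
  extend s (extend s ∘ₗ LinearMap.compRight ℝ (extend s) ∘ₗ
    LinearMap.compRight ℝ (LinearMap.compRight ℝ (Complex.ofRealCLM : ℝ →ₗ[ℝ] ℂ)) ∘ₗ H)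

theorem complexify_cflat {s : (E →L[ℝ] ℝ) →L[ℝ] E} {g : E →L[ℝ] E →L[ℝ] ℝ}
    (hsg : ∀ v, s (g v) = v) (H : E →ₗ[ℝ] E →ₗ[ℝ] E →ₗ[ℝ] ℝ) (x y z : E) :
    complexify s H (cflat g x) (cflat g y) (cflat g z) = H x y z := by
  simp only [complexify, extend_cflat hsg, LinearMap.comp_apply, LinearMap.compRight_apply]
  rfl

/-- The trilinear form `g(D_X Y, Z)` of an endomorphism valued one-form `D`. -/
def jetForm (g : E →L[ℝ] E →L[ℝ] ℝ) (D : E →L[ℝ] E →L[ℝ] E) :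
    E →ₗ[ℝ] E →ₗ[ℝ] E →ₗ[ℝ] ℝ where
  toFun x := LinearMap.mk₂ ℝ (fun y z => g (D x y) z) (by simp) (by simp) (by simp) (by simp)
  map_add' x x' := by ext; simp
  map_smul' c x := by ext; simp

@[simp]
theorem jetForm_apply (g : E →L[ℝ] E →L[ℝ] ℝ) (D : E →L[ℝ] E →L[ℝ] E) (x y z : E) :
    jetForm g D x y z = g (D x y) z := rfl

/-- The torsion `torsion J b` as a trilinear map. -/
def torsionMap (J : E →ₗ[ℝ] E) (b : E →ₗ[ℝ] E →ₗ[ℝ] E →ₗ[ℝ] ℝ) :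
    E →ₗ[ℝ] E →ₗ[ℝ] E →ₗ[ℝ] ℝ where
  toFun x := LinearMap.mk₂ ℝ (torsion J (b · · ·) x)
    (by intros; simp [torsion]; ring) (by intros; simp [torsion]; ring)
    (by intros; simp [torsion]; ring) (by intros; simp [torsion]; ring)
  map_add' x x' := by ext; simp [torsion]; ring
  map_smul' c x := by ext; simp [torsion]; ring

@[simp]
theorem torsionMap_apply (J : E →ₗ[ℝ] E) (b : E →ₗ[ℝ] E →ₗ[ℝ] E →ₗ[ℝ] ℝ) (x y z : E) :
    torsionMap J b x y z = torsion J (b · · ·) x y z := rfl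

/-- The values at a point of the metric `g`, its inverse `s`, the complex structures `J`, `S` and
their covariant derivatives `J'`, `S'`, together with the identities that they satisfy. -/
structure IsBihermitianJet (g : E →L[ℝ] E →L[ℝ] ℝ) (s : (E →L[ℝ] ℝ) →L[ℝ] E) (J S : E →L[ℝ] E)
    (J' S' : E →L[ℝ] E →L[ℝ] E) : Prop where
  symm : ∀ v w, g v w = g w v
  left_inv : ∀ v, s (g v) = v
  right_inv : ∀ a, g (s a) = a
  skew_fst : ∀ v w, g (J v) w = -g v (J w)
  skew_snd : ∀ v w, g (S v) w = -g v (S w)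
  fst : IsHermitianJet (J : E →ₗ[ℝ] E) (jetForm g J')
  snd : IsHermitianJet (S : E →ₗ[ℝ] E) (jetForm g S')
  torsion_eq : ∀ x y z, torsion (S : E →ₗ[ℝ] E) (jetForm g S' · · ·) x y z
    = -torsion (J : E →ₗ[ℝ] E) (jetForm g J' · · ·) x y z

variable {g : E →L[ℝ] E →L[ℝ] ℝ} {s : (E →L[ℝ] ℝ) →L[ℝ] E} {J S : E →L[ℝ] E}
  {J' S' : E →L[ℝ] E →L[ℝ] E}

/-- The complex bivector attached to the metric and to `J`, `S`. -/
def bivec (s : (E →L[ℝ] ℝ) →L[ℝ] E) (J S : E →L[ℝ] E) (α β : E →L[ℝ] ℂ) : ℂ :=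
  pairing s (poissonEnd (coAct J) (coAct S) α) β

/-- The real part of the Hamiltonian vector of a complex covector. -/
def hamRe (s : (E →L[ℝ] ℝ) →L[ℝ] E) (J S : E →L[ℝ] E) (α : E →L[ℝ] ℂ) : E :=
  s (Complex.reCLM.comp (poissonEnd (coAct J) (coAct S) α))

/-- The imaginary part of the Hamiltonian vector of a complex covector. -/
def hamIm (s : (E →L[ℝ] ℝ) →L[ℝ] E) (J S : E →L[ℝ] E) (α : E →L[ℝ] ℂ) : E :=
  s (Complex.imCLM.comp (poissonEnd (coAct J) (coAct S) α))

theorem bivec_eq_ham (s : (E →L[ℝ] ℝ) →L[ℝ] E) (J S : E →L[ℝ] E) (α β : E →L[ℝ] ℂ) :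
    bivec s J S α β = β (hamRe s J S α) + Complex.I * β (hamIm s J S α) := rfl

/-- The covariant derivative of the bivector in the direction `v`. -/
def bivecDeriv (s : (E →L[ℝ] ℝ) →L[ℝ] E) (J S : E →L[ℝ] E) (J' S' : E →L[ℝ] E →L[ℝ] E) (v : E)
    (β γ : E →L[ℝ] ℂ) : ℂ :=
  pairing s (-β.comp ((J' v).comp S + J.comp (S' v) - (S' v).comp J - S.comp (J' v))
    - Complex.I • β.comp (((J' v).comp S + J.comp (S' v) - (S' v).comp J - S.comp (J' v)).comp J
      + (J.comp S - S.comp J).comp (J' v))) γ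

theorem coAct_cflat {B : E →L[ℝ] E} (hB : ∀ v w, g (B v) w = -g v (B w)) (v : E) :
    coAct B (cflat g v) = cflat g (B v) := by
  ext w
  simp [cflat, hB]

theorem coAct_coAct {B : E →L[ℝ] E} (hB : ∀ v, B (B v) = -v) (α : E →L[ℝ] ℂ) :
    coAct B (coAct B α) = -α := by
  ext w
  simp [hB]

/-- `C = [J, S]` is a commutator of skew maps, hence skew. The transpose of `JC` is `CJ = -JC`, so
`JC` is skew too. -/
theorem bivec_antisymm (hgs : ∀ a, g (s a) = a) (hsg : ∀ v, s (g v) = v)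
    (hg : ∀ v w, g v w = g w v) (hsq : ∀ v, J (J v) = -v) (hJ : ∀ v w, g (J v) w = -g v (J w))
    (hS : ∀ v w, g (S v) w = -g v (S w)) (α β : E →L[ℝ] ℂ) :
    bivec s J S α β = -bivec s J S β α := by
  have hJ' : ∀ β γ, pairing s (coAct J β) γ = -pairing s β (coAct J γ) := fun β γ => by
    rw [coAct_apply, coAct_apply, pairing_neg_left, pairing_neg_right,
      pairing_comp hgs hsg hg hJ]
  have hS' : ∀ β γ, pairing s (coAct S β) γ = -pairing s β (coAct S γ) := fun β γ => by
    rw [coAct_apply, coAct_apply, pairing_neg_left, pairing_neg_right,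
      pairing_comp hgs hsg hg hS]
  rw [bivec, bivec, pairing_symm hgs hsg hg _ α, poissonEnd_apply (coAct_coAct hsq),
    poissonEnd_apply (coAct_coAct hsq)]
  simp only [sub_eq_add_neg, pairing_add_left, pairing_add_right, pairing_neg_left,
    pairing_neg_right, pairing_smul_left, pairing_smul_right, hJ', hS']
  ring

namespace IsBihermitianJet

variable (h : IsBihermitianJet g s J S J' S')
include h

theorem complexify_swap_right (x y z : E →L[ℝ] ℂ) :
    complexify s (torsionMap J (jetForm g J')) x y z
      = -complexify s (torsionMap J (jetForm g J')) x z y := by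
  rw [← sub_eq_zero]
  refine trilinear_eq_zero h.right_inv (fun x y z => complexify s (torsionMap J (jetForm g J')) x y z
    - -complexify s (torsionMap J (jetForm g J')) x z y) ?_ ?_ ?_ ?_ x y z
  iterate 3
    · intros
      simp only [map_add, map_smul, LinearMap.add_apply, LinearMap.smul_apply, smul_eq_mul]
      ring
  · intro x y z
    simp only [complexify_cflat h.left_inv, torsionMap_apply]
    rw [h.fst.torsion_swap_right]
    simp

theorem complexify_swap_left (x y z : E →L[ℝ] ℂ) :
    complexify s (torsionMap J (jetForm g J')) x y z
      = -complexify s (torsionMap J (jetForm g J')) y x z := by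
  rw [← sub_eq_zero]
  refine trilinear_eq_zero h.right_inv (fun x y z => complexify s (torsionMap J (jetForm g J')) x y z
    - -complexify s (torsionMap J (jetForm g J')) y x z) ?_ ?_ ?_ ?_ x y z
  iterate 3
    · intros
      simp only [map_add, map_smul, LinearMap.add_apply, LinearMap.smul_apply, smul_eq_mul]
      ring
  · intro x y z
    simp only [complexify_cflat h.left_inv, torsionMap_apply]
    rw [torsion_cyclic, h.fst.torsion_swap_right, torsion_cyclic, torsion_cyclic]
    simp

theorem isMixed_fst :
    IsMixed (coAct J) (complexify s (torsionMap J (jetForm g J'))) := by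
  intro x y z
  rw [← sub_eq_zero]
  set H := complexify s (torsionMap J (jetForm g J')) with hH
  refine trilinear_eq_zero h.right_inv (fun x y z => H (coAct J x) (coAct J y) z
    + H x (coAct J y) (coAct J z) + H (coAct J x) y (coAct J z) - H x y z) ?_ ?_ ?_ ?_ x y z
  iterate 3
    · intros
      simp only [map_add, map_smul, LinearMap.add_apply, LinearMap.smul_apply, smul_eq_mul]
      ring
  · intro x y z
    simp only [coAct_cflat h.skew_fst, hH, complexify_cflat h.left_inv, torsionMap_apply]
    rw [← h.fst.torsion_mixed x y z]
    push_cast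
    simp

/-- The torsion of `S` is `-H`, and the mixed type condition is insensitive to the sign. This is
where the relation between the two `d^c` operators enters beyond the formula for `∇S`. -/
theorem isMixed_snd :
    IsMixed (coAct S) (complexify s (torsionMap J (jetForm g J'))) := by
  intro x y z
  rw [← sub_eq_zero]
  set H := complexify s (torsionMap J (jetForm g J')) with hH
  refine trilinear_eq_zero h.right_inv (fun x y z => H (coAct S x) (coAct S y) z
    + H x (coAct S y) (coAct S z) + H (coAct S x) y (coAct S z) - H x y z) ?_ ?_ ?_ ?_ x y z
  iterate 3
    · intros
      simp only [map_add, map_smul, LinearMap.add_apply, LinearMap.smul_apply, smul_eq_mul]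
      ring
  · intro x y z
    simp only [coAct_cflat h.skew_snd, hH, complexify_cflat h.left_inv, torsionMap_apply]
    have h₁ := h.snd.torsion_mixed x y z
    simp only [h.torsion_eq] at h₁
    norm_cast
    simp only [ContinuousLinearMap.coe_coe] at *
    linarith

/-- Complexified form of `IsHermitianJet.eq_torsion`; the signs are reversed because `β ∘ J'`
represents `-J'` applied to the vector dual to `β`. -/
theorem pairing_comp_fst (v : E) (β γ : E →L[ℝ] ℂ) :
    pairing s (β.comp (J' v)) γ
      = complexify s (torsionMap J (jetForm g J')) (cflat g v) (coAct J β) γ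
        + complexify s (torsionMap J (jetForm g J')) (cflat g v) β (coAct J γ) := by
  rw [← sub_eq_zero]
  set H := complexify s (torsionMap J (jetForm g J')) with hH
  refine bilinear_eq_zero h.right_inv (fun β γ => pairing s (β.comp (J' v)) γ
    - (H (cflat g v) (coAct J β) γ + H (cflat g v) β (coAct J γ))) ?_ ?_ ?_ β γ
  · intros
    simp only [map_add, map_smul, LinearMap.add_apply, LinearMap.smul_apply, smul_eq_mul,
      ContinuousLinearMap.add_comp, ContinuousLinearMap.smul_comp, pairing_add_left,
      pairing_smul_left]
    ring
  · intros
    simp only [map_add, map_smul, smul_eq_mul, pairing_add_right, pairing_smul_right]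
    ring
  · intro y z
    simp only [coAct_cflat h.skew_fst, hH, complexify_cflat h.left_inv, torsionMap_apply]
    rw [pairing_symm h.right_inv h.left_inv h.symm, pairing_cflat_left h.left_inv]
    have h₁ := h.fst.eq_torsion v z y
    rw [h.fst.torsion_swap_right v z, h.fst.torsion_swap_right v _ y] at h₁
    simp only [ContinuousLinearMap.coe_coe, cflat, jetForm_apply, ContinuousLinearMap.comp_apply,
      Complex.ofRealCLM_apply] at *
    rw [h.symm, h₁]
    push_cast
    ring

/-- Same as for `J`, with `-H` in place of `H`. -/
theorem pairing_comp_snd (v : E) (β γ : E →L[ℝ] ℂ) :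
    pairing s (β.comp (S' v)) γ
      = -complexify s (torsionMap J (jetForm g J')) (cflat g v) (coAct S β) γ
        - complexify s (torsionMap J (jetForm g J')) (cflat g v) β (coAct S γ) := by
  rw [← sub_eq_zero]
  set H := complexify s (torsionMap J (jetForm g J')) with hH
  refine bilinear_eq_zero h.right_inv (fun β γ => pairing s (β.comp (S' v)) γ
    - (-H (cflat g v) (coAct S β) γ - H (cflat g v) β (coAct S γ))) ?_ ?_ ?_ β γ
  · intros
    simp only [map_add, map_smul, LinearMap.add_apply, LinearMap.smul_apply, smul_eq_mul,
      ContinuousLinearMap.add_comp, ContinuousLinearMap.smul_comp, pairing_add_left,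
      pairing_smul_left]
    ring
  · intros
    simp only [map_add, map_smul, smul_eq_mul, pairing_add_right, pairing_smul_right]
    ring
  · intro y z
    simp only [coAct_cflat h.skew_snd, hH, complexify_cflat h.left_inv, torsionMap_apply]
    rw [pairing_symm h.right_inv h.left_inv h.symm, pairing_cflat_left h.left_inv]
    have h₁ := h.snd.eq_torsion v z y
    rw [h.torsion_eq, h.torsion_eq, h.fst.torsion_swap_right v z,
      h.fst.torsion_swap_right v _ y]
      at h₁
    simp only [ContinuousLinearMap.coe_coe, cflat, jetForm_apply, ContinuousLinearMap.comp_apply,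
      Complex.ofRealCLM_apply] at *
    rw [h.symm, h₁]
    push_cast
    ring

/-- Leibniz rule for `JS - SJ` and for `J(JS - SJ)`, with `∇J` and `∇S` replaced by their
expressions in `H`. Passing to covectors reverses the order of composition. -/
theorem bivecDeriv_eq (v : E) (β γ : E →L[ℝ] ℂ) :
    bivecDeriv s J S J' S' v β γ
      = torsionForm (coAct J) (coAct S) (complexify s (torsionMap J (jetForm g J'))) (cflat g v)
          β γ := by
  have hJ : ∀ β γ, pairing s (β.comp J) γ = pairing s β (coAct J γ) := fun β γ => by
    rw [pairing_comp h.right_inv h.left_inv h.symm h.skew_fst, coAct_apply, pairing_neg_right]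
  have hS : ∀ β γ, pairing s (β.comp S) γ = pairing s β (coAct S γ) := fun β γ => by
    rw [pairing_comp h.right_inv h.left_inv h.symm h.skew_snd, coAct_apply, pairing_neg_right]
  have eJ : ∀ β : E →L[ℝ] ℂ, β.comp J = -coAct J β := fun β => by simp
  have eS : ∀ β : E →L[ℝ] ℂ, β.comp S = -coAct S β := fun β => by simp
  set H := complexify s (torsionMap J (jetForm g J')) (cflat g v) with hH
  have key : ∀ β γ, pairing s (-β.comp ((J' v).comp S + J.comp (S' v) - (S' v).comp J
      - S.comp (J' v))) γ = torsionReal (coAct J) (coAct S)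
        (complexify s (torsionMap J (jetForm g J'))) (cflat g v) β γ := by
    intro β γ
    have h₁ : -β.comp ((J' v).comp S + J.comp (S' v) - (S' v).comp J - S.comp (J' v))
        = -(β.comp (J' v)).comp S + (coAct J β).comp (S' v) + (β.comp (S' v)).comp J
          + -(coAct S β).comp (J' v) := by
      ext w
      simp
      ring
    rw [h₁]
    simp only [pairing_add_left, pairing_neg_left, hJ, hS, h.pairing_comp_fst, h.pairing_comp_snd,
      torsionReal, ← hH, map_add, LinearMap.add_apply]
    ring
  -- The imaginary part is split into the derivative of the commutator followed by composition with
  -- `J`, to which `key` applies, and the commutator times the derivative of `J`.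
  have h₁ : bivecDeriv s J S J' S' v β γ = pairing s (-β.comp ((J' v).comp S + J.comp (S' v)
      - (S' v).comp J - S.comp (J' v)) + Complex.I • (-β.comp ((J' v).comp S + J.comp (S' v)
      - (S' v).comp J - S.comp (J' v))).comp J + Complex.I • (coAct J (coAct S β)
        + -coAct S (coAct J β)).comp (J' v)) γ := by
    rw [bivecDeriv]
    congr 1
    ext w
    simp
    ring
  rw [h₁, pairing_add_left, pairing_add_left, pairing_smul_left, pairing_smul_left, hJ, key, key,
    h.pairing_comp_fst]
  simp only [torsionForm, torsionReal, torsionImag, ← hH, map_add, LinearMap.add_apply, map_neg,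
    LinearMap.neg_apply, coAct_coAct h.fst.sq]
  ring

theorem bivecDeriv_ham (α β γ : E →L[ℝ] ℂ) :
    bivecDeriv s J S J' S' (hamRe s J S α) β γ
      + Complex.I * bivecDeriv s J S J' S' (hamIm s J S α) β γ
      = torsionForm (coAct J) (coAct S) (complexify s (torsionMap J (jetForm g J')))
          (poissonEnd (coAct J) (coAct S) α) β γ := by
  rw [h.bivecDeriv_eq, h.bivecDeriv_eq, ← torsionForm_smul_left, ← torsionForm_add_left, hamRe,
    hamIm, ← eq_cflat_add h.right_inv]

/-- The Jacobi identity at a point. -/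
theorem bivecDeriv_cyclic (α β γ : E →L[ℝ] ℂ) :
    bivecDeriv s J S J' S' (hamRe s J S α) β γ
      + Complex.I * bivecDeriv s J S J' S' (hamIm s J S α) β γ
      + (bivecDeriv s J S J' S' (hamRe s J S β) γ α
        + Complex.I * bivecDeriv s J S J' S' (hamIm s J S β) γ α)
      + (bivecDeriv s J S J' S' (hamRe s J S γ) α β
        + Complex.I * bivecDeriv s J S J' S' (hamIm s J S γ) α β) = 0 := by
  rw [h.bivecDeriv_ham, h.bivecDeriv_ham, h.bivecDeriv_ham]
  exact torsionForm_cyclic (coAct_coAct h.fst.sq) h.complexify_swap_right h.complexify_swap_left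
    h.isMixed_fst h.isMixed_snd α β γ

theorem bivec_symm_neg (α β : E →L[ℝ] ℂ) : bivec s J S α β = -bivec s J S β α :=
  bivec_antisymm h.right_inv h.left_inv h.symm h.fst.sq h.skew_fst h.skew_snd α β

/-- The equation `∂̄P = 0` at a point. -/
theorem bivecDeriv_zeroOne (Y : E) (α β : E →L[ℝ] ℂ) (hα : α.comp J = Complex.I • α)
    (hβ : β.comp J = Complex.I • β) :
    bivecDeriv s J S J' S' Y α β + Complex.I * bivecDeriv s J S J' S' (J Y) α β
      + Complex.I * (α (J' (hamRe s J S β) Y) + Complex.I * α (J' (hamIm s J S β) Y))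
      - Complex.I * (β (J' (hamRe s J S α) Y) + Complex.I * β (J' (hamIm s J S α) Y)) = 0 := by
  -- Under the metric a covector of type `(1,0)` corresponds to a vector of type `(0,1)`.
  have hα' : coAct J α = -Complex.I • α := by rw [coAct_apply, hα]; exact (neg_smul _ _).symm
  have hβ' : coAct J β = -Complex.I • β := by rw [coAct_apply, hβ]; exact (neg_smul _ _).symm
  set H := complexify s (torsionMap J (jetForm g J')) with hH
  -- The terms in `∇J`, which come from differentiating the coefficients of `Y + iJY`, are values of
  -- `H` with `Y + iJY` in one slot.
  have key : ∀ α : E →L[ℝ] ℂ, coAct J α = -Complex.I • α → ∀ β,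
      Complex.I * (α (J' (hamRe s J S β) Y) + Complex.I * α (J' (hamIm s J S β) Y))
        = H (poissonEnd (coAct J) (coAct S) β) α (cflat g Y + Complex.I • coAct J (cflat g Y)) := by
    intro α hα β
    have h₃ : ∀ v, Complex.I * α (J' v Y)
        = H (cflat g v) α (cflat g Y + Complex.I • coAct J (cflat g Y)) := by
      intro v
      have h₄ := h.pairing_comp_fst v α (cflat g Y)
      rw [pairing_symm h.right_inv h.left_inv h.symm, pairing_cflat_left h.left_inv, hα,
        ContinuousLinearMap.comp_apply, ← hH] at h₄
      rw [h₄]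
      simp only [map_smul, LinearMap.smul_apply, smul_eq_mul, map_add]
      linear_combination -H (cflat g v) α (cflat g Y) * Complex.I_mul_I
    rw [mul_add, mul_left_comm, h₃, h₃]
    conv_rhs => rw [eq_cflat_add h.right_inv (poissonEnd (coAct J) (coAct S) β)]
    simp only [map_add, map_smul, LinearMap.add_apply, LinearMap.smul_apply, smul_eq_mul, hamRe,
      hamIm]
    ring
  have h₅ := torsionForm_zeroOne (S := coAct S) (coAct_coAct h.fst.sq) h.isMixed_fst (cflat g Y)
    hα' hβ'
  rw [key α hα', key β hβ', h.bivecDeriv_eq, h.bivecDeriv_eq,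
    ← coAct_cflat h.skew_fst, ← torsionForm_smul_left]
  rw [torsionForm_add_left] at h₅
  set W := cflat g Y + Complex.I • coAct J (cflat g Y)
  rw [← hH] at *
  have swap_right : ∀ x y z, H x y z = -H x z y := h.complexify_swap_right
  have swap_left : ∀ x y z, H x y z = -H y x z := h.complexify_swap_left
  set a := poissonEnd (coAct J) (coAct S) α
  set b := poissonEnd (coAct J) (coAct S) β
  linear_combination h₅ + swap_right b α W - swap_left b W α + swap_right W b α
    - swap_right a β W + swap_left a W β

end IsBihermitianJet

end Jet

/-! ### Christoffel tensor and derivatives of the pairing -/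

section LocalCalculus

open Filter Topology

variable {E : Type*} [NormedAddCommGroup E] [NormedSpace ℝ E]

/-- The covariant derivative of an endomorphism field `J` with derivative `D`. -/
def covDeriv (Γ : E →L[ℝ] E →L[ℝ] E) (J : E →L[ℝ] E) (D : E →L[ℝ] E →L[ℝ] E) :
    E →L[ℝ] E →L[ℝ] E :=
  D + ((ContinuousLinearMap.compL ℝ E E E).flip J).comp Γ
    - (ContinuousLinearMap.compL ℝ E E E J).comp Γ

@[simp]
theorem covDeriv_apply (Γ : E →L[ℝ] E →L[ℝ] E) (J : E →L[ℝ] E) (D : E →L[ℝ] E →L[ℝ] E)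
    (v w : E) : covDeriv Γ J D v w = D v w + Γ v (J w) - J (Γ v w) := rfl

set_option maxSynthPendingDepth 3 in
/-- The Levi-Civita connection at a point, for a metric with inverse `s` and derivative `D`. -/
theorem exists_leviCivita {g : E →L[ℝ] E →L[ℝ] ℝ} {s : (E →L[ℝ] ℝ) →L[ℝ] E}
    (hg : ∀ v w, g v w = g w v) (hgs : ∀ a, g (s a) = a) (D : E →L[ℝ] E →L[ℝ] E →L[ℝ] ℝ)
    (hD : ∀ u v w, D u v w = D u w v) :
    ∃ Γ : E →L[ℝ] E →L[ℝ] E, (∀ u v, Γ u v = Γ v u) ∧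
      ∀ u v w, D u v w = g (Γ u v) w + g v (Γ u w) := by
  let flipL : (E →L[ℝ] E →L[ℝ] ℝ) →L[ℝ] (E →L[ℝ] E →L[ℝ] ℝ) :=
    (ContinuousLinearMap.flipₗᵢ ℝ E E ℝ).toContinuousLinearEquiv
  -- Koszul's formula for the lowered Christoffel tensor of constant vector fields; `s` then raises
  -- its last index.
  let K : E →L[ℝ] E →L[ℝ] E →L[ℝ] ℝ := (1 / 2 : ℝ) • (D + D.flip - flipL.comp D.flip)
  have hK : ∀ u v w, K u v w = (D u v w + D v u w - D w u v) / 2 := by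
    intro u v w
    have : K u v w = (1 / 2 : ℝ) * (D u v w + D v u w - D w u v) := rfl
    rw [this]
    ring
  have key : ∀ u v w, g (s (K u v)) w = (D u v w + D v u w - D w u v) / 2 := fun u v w => by
    rw [hgs, hK]
  refine ⟨(ContinuousLinearMap.compL ℝ E (E →L[ℝ] ℝ) E s).comp K, fun u v => ?_, fun u v w => ?_⟩
  · change s (K u v) = s (K v u)
    congr 1
    ext w
    rw [hK, hK, hD w u v]
    ring
  · change _ = g (s (K u v)) w + g v (s (K u w))
    rw [key, hg v, key, hD v u w, hD w u v, hD u w v]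
    ring

theorem bivec_eq_pairing (s : (E →L[ℝ] ℝ) →L[ℝ] E) (J S : E →L[ℝ] E) (α β : E →L[ℝ] ℂ) :
    bivec s J S α β = pairing s (-α.comp (J.comp S - S.comp J)
      - Complex.I • α.comp ((J.comp S - S.comp J).comp J)) β := by
  rw [bivec]
  congr 1
  ext w
  simp [poissonEnd]

theorem bivec_add_left (s : (E →L[ℝ] ℝ) →L[ℝ] E) (J S : E →L[ℝ] E) (α α' β : E →L[ℝ] ℂ) :
    bivec s J S (α + α') β = bivec s J S α β + bivec s J S α' β := by
  simp only [bivec, map_add, pairing_add_left]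

theorem bivec_smul_left (s : (E →L[ℝ] ℝ) →L[ℝ] E) (J S : E →L[ℝ] E) (c : ℂ) (α β : E →L[ℝ] ℂ) :
    bivec s J S (c • α) β = c * bivec s J S α β := by
  simp only [bivec, map_smul, pairing_smul_left]

theorem bivec_add_right (s : (E →L[ℝ] ℝ) →L[ℝ] E) (J S : E →L[ℝ] E) (α β β' : E →L[ℝ] ℂ) :
    bivec s J S α (β + β') = bivec s J S α β + bivec s J S α β' :=
  pairing_add_right _ _ _ _

theorem bivec_smul_right (s : (E →L[ℝ] ℝ) →L[ℝ] E) (J S : E →L[ℝ] E) (c : ℂ) (α β : E →L[ℝ] ℂ) :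
    bivec s J S α (c • β) = c * bivec s J S α β :=
  pairing_smul_right _ _ _ _

theorem _root_.ContDiffAt.bivec {F : Type*} [NormedAddCommGroup F] [NormedSpace ℝ F]
    {n : WithTop ℕ∞} {s : F → (E →L[ℝ] ℝ) →L[ℝ] E}
    {J S : F → E →L[ℝ] E} {α β : F → E →L[ℝ] ℂ} {z : F} (hs : ContDiffAt ℝ n s z)
    (hJ : ContDiffAt ℝ n J z) (hS : ContDiffAt ℝ n S z) (hα : ContDiffAt ℝ n α z)
    (hβ : ContDiffAt ℝ n β z) :
    ContDiffAt ℝ n (fun y => bivec (s y) (J y) (S y) (α y) (β y)) z := by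
  have hC := (hJ.clm_comp hS).sub (hS.clm_comp hJ)
  have hw := (hα.clm_comp hC).neg.sub ((hα.clm_comp (hC.clm_comp hJ)).const_smul Complex.I)
  simp only [bivec_eq_pairing, pairing]
  exact (hβ.clm_apply (hs.clm_apply (contDiffAt_const.clm_comp hw))).add
    (contDiffAt_const.mul (hβ.clm_apply (hs.clm_apply (contDiffAt_const.clm_comp hw))))

set_option maxSynthPendingDepth 3 in
theorem hasFDerivAt_pairing {s : E → (E →L[ℝ] ℝ) →L[ℝ] E} {w β : E → E →L[ℝ] ℂ} {z : E}
    {s' : E →L[ℝ] (E →L[ℝ] ℝ) →L[ℝ] E} {w' β' : E →L[ℝ] E →L[ℝ] ℂ}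
    (hs : HasFDerivAt s s' z) (hw : HasFDerivAt w w' z) (hβ : HasFDerivAt β β' z) :
    ∃ L : E →L[ℝ] ℂ, HasFDerivAt (fun y => pairing (s y) (w y) (β y)) L z ∧
      ∀ v, L v = pairing (s' v) (w z) (β z) + pairing (s z) (w' v) (β z)
        + pairing (s z) (w z) (β' v) := by
  have hre := hβ.clm_apply (hs.clm_apply ((hasFDerivAt_const Complex.reCLM z).clm_comp hw))
  have him := hβ.clm_apply (hs.clm_apply ((hasFDerivAt_const Complex.imCLM z).clm_comp hw))
  refine ⟨_, hre.add (him.const_mul Complex.I), fun v => ?_⟩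
  simp [pairing]
  ring

/-- The inverse metric is parallel. This follows from `∇g = 0` by differentiating `s ∘ g = id`. -/
theorem pairing_deriv {g : E →L[ℝ] E →L[ℝ] ℝ} {s : (E →L[ℝ] ℝ) →L[ℝ] E}
    (hg : ∀ v w, g v w = g w v) (hsg : ∀ v, s (g v) = v) (hgs : ∀ a, g (s a) = a)
    {g' : E →L[ℝ] E →L[ℝ] ℝ} {s' : (E →L[ℝ] ℝ) →L[ℝ] E} {Γ : E →L[ℝ] E}
    (hs' : ∀ x, s' (g x) + s (g' x) = 0) (hΓ : ∀ v w, g' v w = g (Γ v) w + g v (Γ w))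
    (w β : E →L[ℝ] ℂ) :
    pairing s' w β = -pairing s (w.comp Γ) β - pairing s w (β.comp Γ) := by
  rw [← sub_eq_zero]
  refine bilinear_eq_zero hgs (fun w β => pairing s' w β
    - (-pairing s (w.comp Γ) β - pairing s w (β.comp Γ))) ?_ ?_ ?_ w β
  iterate 2
    · intros
      simp only [ContinuousLinearMap.add_comp, ContinuousLinearMap.smul_comp, pairing_add_left,
        pairing_smul_left, pairing_add_right, pairing_smul_right]
      ring
  · intro x y
    have h₁ : pairing s' (cflat g x) (cflat g y) = -(g' x y : ℂ) := by
      have h₂ : Complex.reCLM.comp (cflat g x) = g x := by ext; simp [cflat]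
      have h₃ : Complex.imCLM.comp (cflat g x) = 0 := by ext; simp [cflat]
      rw [pairing, h₂, h₃, map_zero, map_zero, mul_zero, add_zero, eq_neg_of_add_eq_zero_left (hs' x)]
      simp only [cflat, ContinuousLinearMap.comp_apply, map_neg, Complex.ofRealCLM_apply]
      rw [hg, hgs]
    rw [h₁, pairing_symm hgs hsg hg ((cflat g x).comp Γ), pairing_cflat_left hsg,
      pairing_cflat_left hsg, hΓ]
    simp only [cflat, ContinuousLinearMap.comp_apply, Complex.ofRealCLM_apply]
    rw [hg (Γ x)]
    push_cast
    ring

end LocalCalculus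

/-! ### Germs of Hermitian and bihermitian structures on a vector space -/

section Germ

open Filter Topology

set_option maxSynthPendingDepth 3

variable {E : Type*} [NormedAddCommGroup E] [NormedSpace ℝ E]

/-- The derivative `(D_X F)(Y, Z)` of `F(Y, Z) = g(JY, Z)`. -/
def kahlerDeriv (g : E → E →L[ℝ] E →L[ℝ] ℝ) (J : E → E →L[ℝ] E) (z X Y Z : E) : ℝ :=
  fderiv ℝ g z X (J z Y) Z + g z (fderiv ℝ J z X Y) Z

/-- The germ at `z` of an integrable Hermitian structure on a vector space. -/
structure IsHermitianGerm (g : E → E →L[ℝ] E →L[ℝ] ℝ) (J : E → E →L[ℝ] E) (z : E) : Prop where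
  smooth_metric : ContDiffAt ℝ ∞ g z
  smooth : ContDiffAt ℝ ∞ J z
  symm : ∀ᶠ y in 𝓝 z, ∀ v w, g y v w = g y w v
  sq : ∀ᶠ y in 𝓝 z, ∀ v, J y (J y v) = -v
  compat : ∀ᶠ y in 𝓝 z, ∀ v w, g y (J y v) (J y w) = g y v w
  nijenhuis : ∀ u v, fderiv ℝ J z (J z u) v - fderiv ℝ J z (J z v) u
    + J z (fderiv ℝ J z v u) - J z (fderiv ℝ J z u v) = 0

variable {g : E → E →L[ℝ] E →L[ℝ] ℝ} {J S : E → E →L[ℝ] E} {z : E}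

namespace IsHermitianGerm

variable (h : IsHermitianGerm g J z)
include h

theorem skew : ∀ᶠ y in 𝓝 z, ∀ v w, g y (J y v) w = -g y v (J y w) := by
  filter_upwards [h.sq, h.compat] with y h₁ h₂ v w
  rw [← h₂ (J y v) w, h₁]
  simp

theorem hasFDerivAt_metric : HasFDerivAt g (fderiv ℝ g z) z :=
  (h.smooth_metric.differentiableAt (by simp)).hasFDerivAt

theorem hasFDerivAt : HasFDerivAt J (fderiv ℝ J z) z :=
  (h.smooth.differentiableAt (by simp)).hasFDerivAt

theorem deriv_symm (u v w : E) : fderiv ℝ g z u v w = fderiv ℝ g z u w v := by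
  have h₁ := (h.hasFDerivAt_metric.clm_apply (hasFDerivAt_const v z)).clm_apply
    (hasFDerivAt_const w z)
  have h₂ := (h.hasFDerivAt_metric.clm_apply (hasFDerivAt_const w z)).clm_apply
    (hasFDerivAt_const v z)
  have h₃ := h₁.unique (h₂.congr_of_eventuallyEq (h.symm.mono fun y hy => hy v w))
  simpa using congr($h₃ u)

theorem deriv_skew (u v w : E) :
    fderiv ℝ g z u (J z v) w + g z (fderiv ℝ J z u v) w
      = -(fderiv ℝ g z u v (J z w) + g z v (fderiv ℝ J z u w)) := by
  have h₁ := (h.hasFDerivAt_metric.clm_apply (h.hasFDerivAt.clm_apply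
    (hasFDerivAt_const v z))).clm_apply (hasFDerivAt_const w z)
  have h₂ := (h.hasFDerivAt_metric.clm_apply (hasFDerivAt_const v z)).clm_apply
    (h.hasFDerivAt.clm_apply (hasFDerivAt_const w z))
  have h₃ := h₁.unique (h₂.neg.congr_of_eventuallyEq (h.skew.mono fun y hy => hy v w))
  have h₄ := congr($h₃ u)
  simp at h₄
  linarith

theorem deriv_sq (u v : E) : fderiv ℝ J z u (J z v) + J z (fderiv ℝ J z u v) = 0 := by
  have h₁ := h.hasFDerivAt.clm_apply (h.hasFDerivAt.clm_apply (hasFDerivAt_const v z))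
  have h₃ := h₁.unique ((hasFDerivAt_const (-v) z).congr_of_eventuallyEq
    (h.sq.mono fun y hy => hy v))
  have h₄ := congr($h₃ u)
  simpa [add_comm] using h₄

variable {Γ : E →L[ℝ] E →L[ℝ] E} (hΓ : ∀ u v, Γ u v = Γ v u)
  (hg : ∀ u v w, fderiv ℝ g z u v w = g z (Γ u v) w + g z v (Γ u w))
include hΓ hg

/-- The algebraic identities for `J` hold near `z`, so they may be differentiated there; metric
compatibility turns ordinary derivatives into covariant ones. In the Nijenhuis identity the
Christoffel terms cancel by the symmetry of `Γ`. -/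
theorem isHermitianJet :
    IsHermitianJet (J z : E →ₗ[ℝ] E) (jetForm (g z) (covDeriv Γ (J z) (fderiv ℝ J z))) where
  sq x := h.sq.self_of_nhds x
  skew u v w := by
    have h₁ := h.deriv_skew u v w
    have h₂ := h.skew.self_of_nhds
    have h₃ := h.symm.self_of_nhds
    simp only [hg, jetForm_apply, covDeriv_apply, map_add, map_sub, add_apply, sub_apply, h₂] at h₁ ⊢
    rw [h₃ (Γ u (J z w)), h₃ (Γ u w), h₂, h₃ (fderiv ℝ J z u w)]
    linarith
  anti u v w := by
    have h₁ := congr(g z $(h.deriv_sq u v) w)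
    have h₂ := h.skew.self_of_nhds
    simp only [jetForm_apply, ContinuousLinearMap.coe_coe, covDeriv_apply, map_add, map_sub,
      add_apply, sub_apply, h₂, h.sq.self_of_nhds, map_neg, neg_apply, map_zero, zero_apply] at h₁ ⊢
    linarith
  nijenhuis u v w := by
    have h₁ := congr(g z $(h.nijenhuis u v) w)
    have h₂ := h.skew.self_of_nhds
    simp only [jetForm_apply, ContinuousLinearMap.coe_coe, covDeriv_apply, map_add, map_sub,
      add_apply, sub_apply, h₂, h.sq.self_of_nhds, map_neg, map_zero, zero_apply,
      hΓ v u, hΓ (J z v) (J z u), hΓ (J z v) u, hΓ (J z u) v] at h₁ ⊢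
    linarith

/-- The Christoffel terms cancel in the cyclic sum because `Γ` is symmetric: `dF` may be computed
with any torsion-free connection. -/
theorem torsion_eq (X Y Z : E) :
    torsion (J z : E →ₗ[ℝ] E) (jetForm (g z) (covDeriv Γ (J z) (fderiv ℝ J z)) · · ·) X Y Z
      = (kahlerDeriv g J z (J z X) (J z Y) (J z Z) + kahlerDeriv g J z (J z Y) (J z Z) (J z X)
        + kahlerDeriv g J z (J z Z) (J z X) (J z Y)) / 2 := by
  have key : ∀ P Q R, g z (covDeriv Γ (J z) (fderiv ℝ J z) P Q) R
      = kahlerDeriv g J z P Q R + g z (Γ P Q) (J z R) - g z (Γ P R) (J z Q) := by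
    intro P Q R
    have h₂ := h.skew.self_of_nhds
    have h₃ := h.symm.self_of_nhds
    simp only [kahlerDeriv, hg, covDeriv_apply, map_add, map_sub, add_apply, sub_apply]
    rw [h₂ (Γ P Q), h₃ (J z Q) (Γ P R)]
    ring
  simp only [torsion, jetForm_apply, ContinuousLinearMap.coe_coe, key]
  rw [hΓ (J z Y) (J z X), hΓ (J z Z) (J z X), hΓ (J z Z) (J z Y)]
  ring

end IsHermitianGerm

/-- The germ at `z` of a pair of integrable Hermitian structures with `d^c_J F_J = -d^c_S F_S`;
`s` is the inverse of the metric `g`. -/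
structure IsBihermitianGerm (g : E → E →L[ℝ] E →L[ℝ] ℝ) (s : E → (E →L[ℝ] ℝ) →L[ℝ] E)
    (J S : E → E →L[ℝ] E) (z : E) : Prop where
  fst : IsHermitianGerm g J z
  snd : IsHermitianGerm g S z
  smooth_inv : ContDiffAt ℝ ∞ s z
  left_inv : ∀ᶠ y in 𝓝 z, ∀ v, s y (g y v) = v
  right_inv : ∀ᶠ y in 𝓝 z, ∀ a, g y (s y a) = a
  dc_eq : ∀ X Y Z, kahlerDeriv g J z (J z X) (J z Y) (J z Z)
      + kahlerDeriv g J z (J z Y) (J z Z) (J z X) + kahlerDeriv g J z (J z Z) (J z X) (J z Y)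
    = -(kahlerDeriv g S z (S z X) (S z Y) (S z Z)
      + kahlerDeriv g S z (S z Y) (S z Z) (S z X) + kahlerDeriv g S z (S z Z) (S z X) (S z Y))

variable {s : E → (E →L[ℝ] ℝ) →L[ℝ] E}

/-- The bracket of two complex functions on a vector space. -/
def localBracket (s : E → (E →L[ℝ] ℝ) →L[ℝ] E) (J S : E → E →L[ℝ] E) (f h : E → ℂ) (y : E) : ℂ :=
  bivec (s y) (J y) (S y) (fderiv ℝ f y) (fderiv ℝ h y)

namespace IsBihermitianGerm

theorem contDiffAt_localBracket (H : IsBihermitianGerm g s J S z) {f h : E → ℂ}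
    (hf : ContDiffAt ℝ ∞ f z) (hh : ContDiffAt ℝ ∞ h z) :
    ContDiffAt ℝ ∞ (localBracket s J S f h) z :=
  H.smooth_inv.bivec H.fst.smooth H.snd.smooth (hf.fderiv_right (by simp))
    (hh.fderiv_right (by simp))

/-- The Levi-Civita connection of a bihermitian germ and the identities it gives rise to. -/
theorem exists_jet (H : IsBihermitianGerm g s J S z) :
    ∃ Γ : E →L[ℝ] E →L[ℝ] E, (∀ u v, Γ u v = Γ v u) ∧
      (∀ u v w, fderiv ℝ g z u v w = g z (Γ u v) w + g z v (Γ u w)) ∧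
      IsBihermitianJet (g z) (s z) (J z) (S z) (covDeriv Γ (J z) (fderiv ℝ J z))
        (covDeriv Γ (S z) (fderiv ℝ S z)) := by
  obtain ⟨Γ, hΓ, hg⟩ := exists_leviCivita H.fst.symm.self_of_nhds H.right_inv.self_of_nhds
    (fderiv ℝ g z) H.fst.deriv_symm
  refine ⟨Γ, hΓ, hg, H.fst.symm.self_of_nhds, H.left_inv.self_of_nhds, H.right_inv.self_of_nhds,
    H.fst.skew.self_of_nhds, H.snd.skew.self_of_nhds, H.fst.isHermitianJet hΓ hg,
    H.snd.isHermitianJet hΓ hg, fun X Y Z => ?_⟩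
  rw [H.fst.torsion_eq hΓ hg, H.snd.torsion_eq hΓ hg, H.dc_eq]
  ring

/-- Leibniz rule for `P(α, β)` in covariant form; `α' v - α ∘ Γ v` is the covariant derivative of
`α`. -/
theorem hasFDerivAt_bivec (H : IsBihermitianGerm g s J S z) {Γ : E →L[ℝ] E →L[ℝ] E}
    (hg : ∀ u v w, fderiv ℝ g z u v w = g z (Γ u v) w + g z v (Γ u w))
    {α β : E → E →L[ℝ] ℂ} {α' β' : E →L[ℝ] E →L[ℝ] ℂ} (hα : HasFDerivAt α α' z)
    (hβ : HasFDerivAt β β' z) :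
    ∃ L : E →L[ℝ] ℂ, HasFDerivAt (fun y => bivec (s y) (J y) (S y) (α y) (β y)) L z ∧
      ∀ v, L v = bivecDeriv (s z) (J z) (S z) (covDeriv Γ (J z) (fderiv ℝ J z))
          (covDeriv Γ (S z) (fderiv ℝ S z)) v (α z) (β z)
        + bivec (s z) (J z) (S z) (α' v - (α z).comp (Γ v)) (β z)
        + bivec (s z) (J z) (S z) (α z) (β' v - (β z).comp (Γ v)) := by
  have hs : HasFDerivAt s (fderiv ℝ s z) z :=
    (H.smooth_inv.differentiableAt (by simp)).hasFDerivAt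
  have hC := (H.fst.hasFDerivAt.clm_comp H.snd.hasFDerivAt).sub
    (H.snd.hasFDerivAt.clm_comp H.fst.hasFDerivAt)
  -- The derivative of `Aα` is grouped as `(∇A)α + A(∇α)` plus a Christoffel correction, which later
  -- cancels against the derivative of the inverse metric.
  obtain ⟨w', hw, hw'⟩ : ∃ w' : E →L[ℝ] E →L[ℝ] ℂ,
      HasFDerivAt (fun y => -(α y).comp ((J y).comp (S y) - (S y).comp (J y))
        - Complex.I • (α y).comp (((J y).comp (S y) - (S y).comp (J y)).comp (J y))) w' z ∧
      ∀ v, w' v = (-(α z).comp ((covDeriv Γ (J z) (fderiv ℝ J z) v).comp (S z)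
          + (J z).comp (covDeriv Γ (S z) (fderiv ℝ S z) v)
          - (covDeriv Γ (S z) (fderiv ℝ S z) v).comp (J z)
          - (S z).comp (covDeriv Γ (J z) (fderiv ℝ J z) v))
        - Complex.I • (α z).comp (((covDeriv Γ (J z) (fderiv ℝ J z) v).comp (S z)
          + (J z).comp (covDeriv Γ (S z) (fderiv ℝ S z) v)
          - (covDeriv Γ (S z) (fderiv ℝ S z) v).comp (J z)
          - (S z).comp (covDeriv Γ (J z) (fderiv ℝ J z) v)).comp (J z)
            + ((J z).comp (S z) - (S z).comp (J z)).comp (covDeriv Γ (J z) (fderiv ℝ J z) v)))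
        + (-(α' v - (α z).comp (Γ v)).comp ((J z).comp (S z) - (S z).comp (J z))
          - Complex.I • (α' v - (α z).comp (Γ v)).comp
            (((J z).comp (S z) - (S z).comp (J z)).comp (J z)))
        + (-(α z).comp ((J z).comp (S z) - (S z).comp (J z))
          - Complex.I • (α z).comp (((J z).comp (S z) - (S z).comp (J z)).comp (J z))).comp (Γ v) := by
    refine ⟨_, (hα.clm_comp hC).neg.sub
      ((hα.clm_comp (hC.clm_comp H.fst.hasFDerivAt)).const_smul Complex.I), fun v => ?_⟩
    ext u
    simp
    ring
  obtain ⟨L, hL, hL'⟩ := hasFDerivAt_pairing hs hw hβ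
  refine ⟨L, by simpa only [bivec_eq_pairing] using! hL, fun v => ?_⟩
  have hs' : ∀ x, fderiv ℝ s z v (g z x) + s z (fderiv ℝ g z v x) = 0 := by
    intro x
    have h₁ := (hs.clm_apply (H.fst.hasFDerivAt_metric.clm_apply
      (hasFDerivAt_const x z))).unique ((hasFDerivAt_const x z).congr_of_eventuallyEq
        (H.left_inv.mono fun y hy => hy x))
    simpa [add_comm] using congr($h₁ v)
  rw [hL', pairing_deriv H.fst.symm.self_of_nhds H.left_inv.self_of_nhds
    H.right_inv.self_of_nhds hs' (hg v)]
  rw [hw', bivec_eq_pairing, bivec_eq_pairing, bivecDeriv, pairing_add_left, pairing_add_left,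
    sub_eq_add_neg (β' v), pairing_add_right, pairing_neg_right]
  ring

end IsBihermitianGerm

end Germ

/-! ### Jacobi identity and holomorphy on the model space -/

section LocalTheorem

open Filter Topology

set_option maxSynthPendingDepth 3

variable {E : Type*} [NormedAddCommGroup E] [NormedSpace ℝ E]
  {g : E → E →L[ℝ] E →L[ℝ] ℝ} {s : E → (E →L[ℝ] ℝ) →L[ℝ] E} {J S : E → E →L[ℝ] E} {z : E}

/-- The derivative of a complex function along the vector field `Y + i JY`. -/
def localZeroOne (J : E → E →L[ℝ] E) (Y : E → E) (f : E → ℂ) (y : E) : ℂ :=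
  fderiv ℝ f y (Y y) + Complex.I * fderiv ℝ f y (J y (Y y))

/-- The Hessian of `f` at `z` with respect to the connection `Γ`. -/
def hessian (Γ : E →L[ℝ] E →L[ℝ] E) (f : E → ℂ) (z v : E) : E →L[ℝ] ℂ :=
  fderiv ℝ (fderiv ℝ f) z v - (fderiv ℝ f z).comp (Γ v)

theorem hessian_comm {Γ : E →L[ℝ] E →L[ℝ] E} (hΓ : ∀ u v, Γ u v = Γ v u) {f : E → ℂ}
    (hf : ContDiffAt ℝ ∞ f z) (u v : E) : hessian Γ f z u v = hessian Γ f z v u := by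
  have h := (hf.isSymmSndFDerivAt (by simpa using WithTop.coe_le_coe.2 (le_top (a := (2 : ℕ∞))))).eq u v
  simp only [hessian, sub_apply, ContinuousLinearMap.comp_apply, h, hΓ u v]

theorem _root_.ContDiffAt.hasFDerivAt_fderiv {f : E → ℂ} (hf : ContDiffAt ℝ ∞ f z) :
    HasFDerivAt (fderiv ℝ f) (fderiv ℝ (fderiv ℝ f) z) z :=
  ((hf.fderiv_right (m := ∞) (by simp)).differentiableAt (by simp)).hasFDerivAt

namespace IsBihermitianGerm

theorem fderiv_localBracket (H : IsBihermitianGerm g s J S z) {Γ : E →L[ℝ] E →L[ℝ] E}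
    (hg : ∀ u v w, fderiv ℝ g z u v w = g z (Γ u v) w + g z v (Γ u w)) {f h : E → ℂ}
    (hf : ContDiffAt ℝ ∞ f z) (hh : ContDiffAt ℝ ∞ h z) (v : E) :
    fderiv ℝ (localBracket s J S f h) z v
      = bivecDeriv (s z) (J z) (S z) (covDeriv Γ (J z) (fderiv ℝ J z))
          (covDeriv Γ (S z) (fderiv ℝ S z)) v (fderiv ℝ f z) (fderiv ℝ h z)
        + bivec (s z) (J z) (S z) (hessian Γ f z v) (fderiv ℝ h z)
        + bivec (s z) (J z) (S z) (fderiv ℝ f z) (hessian Γ h z v) := by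
  obtain ⟨L, hL, hL'⟩ := H.hasFDerivAt_bivec hg hf.hasFDerivAt_fderiv hh.hasFDerivAt_fderiv
  have : fderiv ℝ (localBracket s J S f h) z = L := hL.fderiv
  rw [this, hL']
  rfl

/-- Differentiating the inner brackets gives the cyclic sum of `∇P`, which vanishes, and Hessian
terms evaluated on Hamiltonian vectors. The latter cancel in pairs since the Hessian of a
torsion-free connection is symmetric. -/
theorem jacobi (H : IsBihermitianGerm g s J S z) {f h k : E → ℂ} (hf : ContDiffAt ℝ ∞ f z)
    (hh : ContDiffAt ℝ ∞ h z) (hk : ContDiffAt ℝ ∞ k z) :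
    localBracket s J S f (localBracket s J S h k) z
      + localBracket s J S h (localBracket s J S k f) z
      + localBracket s J S k (localBracket s J S f h) z = 0 := by
  obtain ⟨Γ, hΓ, hg, hjet⟩ := H.exists_jet
  have hJ := hjet.bivecDeriv_cyclic (fderiv ℝ f z) (fderiv ℝ h z) (fderiv ℝ k z)
  rw [localBracket, localBracket, localBracket, bivec_eq_ham, bivec_eq_ham, bivec_eq_ham]
  simp only [H.fderiv_localBracket hg hf hh, H.fderiv_localBracket hg hh hk,
    H.fderiv_localBracket hg hk hf]
  simp only [hjet.bivec_symm_neg (hessian _ _ _ _)]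
  simp only [bivec_eq_ham]
  generalize hamRe (s z) (J z) (S z) (fderiv ℝ f z) = f₁ at *
  generalize hamIm (s z) (J z) (S z) (fderiv ℝ f z) = f₂ at *
  generalize hamRe (s z) (J z) (S z) (fderiv ℝ h z) = h₁ at *
  generalize hamIm (s z) (J z) (S z) (fderiv ℝ h z) = h₂ at *
  generalize hamRe (s z) (J z) (S z) (fderiv ℝ k z) = k₁ at *
  generalize hamIm (s z) (J z) (S z) (fderiv ℝ k z) = k₂ at *
  rw [hessian_comm hΓ hf k₁ h₁, hessian_comm hΓ hf k₁ h₂, hessian_comm hΓ hf k₂ h₁,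
    hessian_comm hΓ hf k₂ h₂, hessian_comm hΓ hh k₁ f₁, hessian_comm hΓ hh k₁ f₂,
    hessian_comm hΓ hh k₂ f₁, hessian_comm hΓ hh k₂ f₂, hessian_comm hΓ hk h₁ f₁,
    hessian_comm hΓ hk h₁ f₂, hessian_comm hΓ hk h₂ f₁, hessian_comm hΓ hk h₂ f₂]
  linear_combination hJ

/-- By the Leibniz rule the Hessian terms from the three summands cancel; what remains is `∇P` along
`Y + iJY` with corrections in `∇J`, handled by `bivecDeriv_zeroOne`. -/
theorem zeroOne (H : IsBihermitianGerm g s J S z) {f h : E → ℂ} {Y : E → E}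
    (hf : ContDiffAt ℝ ∞ f z) (hh : ContDiffAt ℝ ∞ h z) (hY : DifferentiableAt ℝ Y z)
    (hf' : (fderiv ℝ f z).comp (J z) = Complex.I • fderiv ℝ f z)
    (hh' : (fderiv ℝ h z).comp (J z) = Complex.I • fderiv ℝ h z) :
    localZeroOne J Y (localBracket s J S f h) z - localBracket s J S (localZeroOne J Y f) h z
      - localBracket s J S f (localZeroOne J Y h) z = 0 := by
  obtain ⟨Γ, hΓ, hg, hjet⟩ := H.exists_jet
  -- No derivative of `Y` survives: it enters through `df(∇_v Y) + i df(J ∇_v Y)`, which is zero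
  -- because `df ∘ J = i df` at `z`.
  have key : ∀ {f : E → ℂ}, ContDiffAt ℝ ∞ f z →
      (fderiv ℝ f z).comp (J z) = Complex.I • fderiv ℝ f z → ∀ v,
      fderiv ℝ (localZeroOne J Y f) z v = hessian Γ f z (Y z) v
        + Complex.I * hessian Γ f z (J z (Y z)) v
        + Complex.I * fderiv ℝ f z (covDeriv Γ (J z) (fderiv ℝ J z) v (Y z)) := by
    intro f hf hf' v
    have h₁ := (hf.hasFDerivAt_fderiv.clm_apply hY.hasFDerivAt).add
      ((hf.hasFDerivAt_fderiv.clm_apply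
        (H.fst.hasFDerivAt.clm_apply hY.hasFDerivAt)).const_mul Complex.I)
    have h₂ : fderiv ℝ (localZeroOne J Y f) z = _ := h₁.fderiv
    have h₃ : ∀ w, fderiv ℝ f z (J z w) = Complex.I * fderiv ℝ f z w := fun w => by
      simpa using congr($hf' w)
    rw [h₂, hessian_comm hΓ hf _ v, hessian_comm hΓ hf _ v]
    simp only [hessian, covDeriv_apply, add_apply, sub_apply, map_add, map_sub, h₃, smul_apply,
      ContinuousLinearMap.comp_apply, ContinuousLinearMap.flip_apply, smul_eq_mul]
    linear_combination (fderiv ℝ f z (fderiv ℝ Y z v) + fderiv ℝ f z (Γ v (Y z))) * Complex.I_mul_I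
  have hJ := hjet.bivecDeriv_zeroOne (Y z) (fderiv ℝ f z) (fderiv ℝ h z) hf' hh'
  rw [localZeroOne, H.fderiv_localBracket hg hf hh, H.fderiv_localBracket hg hf hh, localBracket,
    localBracket]
  rw [hjet.bivec_symm_neg (hessian _ _ _ _), hjet.bivec_symm_neg (hessian _ _ _ _),
    hjet.bivec_symm_neg (fderiv ℝ (localZeroOne J Y f) z)]
  simp only [bivec_eq_ham, key hf hf', key hh hh']
  linear_combination hJ

end IsBihermitianGerm

end LocalTheorem

/-! ### Reading metrics, endomorphisms and vector fields in a chart -/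

section Chart

open Filter Topology

variable {E : Type*} [NormedAddCommGroup E] [NormedSpace ℝ E] {M : Type*} [TopologicalSpace M]
  [ChartedSpace E M]

/-- The derivative of the inverse of the chart at `x`. -/
def chartInv (x : M) (z : E) : E →L[ℝ] TangentSpace 𝓘(ℝ, E) ((extChartAt 𝓘(ℝ, E) x).symm z) :=
  mfderiv 𝓘(ℝ, E) 𝓘(ℝ, E) (extChartAt 𝓘(ℝ, E) x).symm z

/-- The derivative of the chart at `x`. -/
def chartDeriv (x : M) (z : E) : TangentSpace 𝓘(ℝ, E) ((extChartAt 𝓘(ℝ, E) x).symm z) →L[ℝ] E :=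
  mfderiv 𝓘(ℝ, E) 𝓘(ℝ, E) (extChartAt 𝓘(ℝ, E) x) ((extChartAt 𝓘(ℝ, E) x).symm z)

theorem eventually_mem_target (x : M) :
    ∀ᶠ z in 𝓝 (extChartAt 𝓘(ℝ, E) x x), z ∈ (extChartAt 𝓘(ℝ, E) x).target :=
  extChartAt_target_mem_nhds x

variable [IsManifold 𝓘(ℝ, E) ∞ M]

theorem isManifold_one (E : Type*) [NormedAddCommGroup E] [NormedSpace ℝ E] (M : Type*)
    [TopologicalSpace M] [ChartedSpace E M] [IsManifold 𝓘(ℝ, E) ∞ M] : IsManifold 𝓘(ℝ, E) 1 M :=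
  IsManifold.of_le (n := ∞) (by simp)

theorem chartDeriv_chartInv {x : M} {z : E} (hz : z ∈ (extChartAt 𝓘(ℝ, E) x).target) (v : E) :
    chartDeriv x z (chartInv x z v) = v := by
  have := isManifold_one E M
  have h := mfderiv_extChartAt_comp_mfderivWithin_extChartAt_symm (I := 𝓘(ℝ, E)) hz
  rw [ModelWithCorners.range_eq_univ, mfderivWithin_univ] at h
  exact congr($h v)

theorem chartInv_chartDeriv {x : M} {z : E} (hz : z ∈ (extChartAt 𝓘(ℝ, E) x).target)
    (v : TangentSpace 𝓘(ℝ, E) ((extChartAt 𝓘(ℝ, E) x).symm z)) :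
    chartInv x z (chartDeriv x z v) = v := by
  have := isManifold_one E M
  have h := mfderivWithin_extChartAt_symm_comp_mfderiv_extChartAt (I := 𝓘(ℝ, E)) hz
  rw [ModelWithCorners.range_eq_univ, mfderivWithin_univ] at h
  exact congr($h v)

/-- A metric read in the chart at `x`. -/
def localMetric (g : PseudoRiemannianMetric E M) (x : M) (z : E) : E →L[ℝ] E →L[ℝ] ℝ :=
  ContinuousLinearMap.bilinearComp (E := E) (F := E)
    (g.val ((extChartAt 𝓘(ℝ, E) x).symm z)) (chartInv x z) (chartInv x z)

theorem localMetric_apply (g : PseudoRiemannianMetric E M) (x : M) (z v w : E) :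
    localMetric g x z v w
      = g.val ((extChartAt 𝓘(ℝ, E) x).symm z) (chartInv x z v) (chartInv x z w) := rfl

/-- An endomorphism field read in the chart at `x`. -/
def localEnd (J : ComplexStructure E M) (x : M) (z : E) : E →L[ℝ] E :=
  (chartDeriv x z).comp ((J.toFun ((extChartAt 𝓘(ℝ, E) x).symm z)).comp (chartInv x z))

theorem localEnd_apply (J : ComplexStructure E M) (x : M) (z v : E) :
    localEnd J x z v
      = chartDeriv x z (J.toFun ((extChartAt 𝓘(ℝ, E) x).symm z) (chartInv x z v)) := rfl

/-- A vector field read in the chart at `x`. -/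
def localField (Y : ∀ y : M, TangentSpace 𝓘(ℝ, E) y) (x : M) (z : E) : E :=
  chartDeriv x z (Y ((extChartAt 𝓘(ℝ, E) x).symm z))

omit [IsManifold 𝓘(ℝ, E) ∞ M] in
theorem contDiffAt_comp_symm {F : Type*} [NormedAddCommGroup F] [NormedSpace ℝ F] {u : M → F}
    {x : M} : ContMDiffAt 𝓘(ℝ, E) 𝓘(ℝ, F) ∞ u x ↔
      ContDiffAt ℝ ∞ (u ∘ (extChartAt 𝓘(ℝ, E) x).symm) (extChartAt 𝓘(ℝ, E) x x) := by
  rw [contMDiffAt_iff_source, ModelWithCorners.range_eq_univ, contMDiffWithinAt_univ,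
    contMDiffAt_iff_contDiffAt]

theorem continuousLinearMapAt_eq_chartDeriv {x : M} {z : E}
    (hz : z ∈ (extChartAt 𝓘(ℝ, E) x).target) :
    (trivializationAt E (TangentSpace 𝓘(ℝ, E)) x).continuousLinearMapAt ℝ
      ((extChartAt 𝓘(ℝ, E) x).symm z) = chartDeriv x z := by
  have := isManifold_one E M
  have := (extChartAt 𝓘(ℝ, E) x).map_target hz
  rw [extChartAt_source] at this
  exact TangentBundle.continuousLinearMapAt_trivializationAt this

theorem symmL_eq_chartInv {x : M} {z : E} (hz : z ∈ (extChartAt 𝓘(ℝ, E) x).target) :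
    (trivializationAt E (TangentSpace 𝓘(ℝ, E)) x).symmL ℝ
      ((extChartAt 𝓘(ℝ, E) x).symm z) = chartInv x z := by
  have := isManifold_one E M
  have h := (extChartAt 𝓘(ℝ, E) x).map_target hz
  rw [extChartAt_source] at h
  rw [TangentBundle.symmL_trivializationAt h, ModelWithCorners.range_eq_univ, mfderivWithin_univ,
    (extChartAt 𝓘(ℝ, E) x).right_inv hz]
  rfl

theorem contDiffAt_localEnd (J : ComplexStructure E M) (x : M) :
    ContDiffAt ℝ ∞ (localEnd J x) (extChartAt 𝓘(ℝ, E) x x) := by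
  have h := (contMDiffAt_hom_bundle _).1 (J.smooth x)
  refine (contDiffAt_comp_symm.1 h.2).congr_of_eventuallyEq ?_
  filter_upwards [eventually_mem_target x] with z hz
  rw [Function.comp_apply, ContinuousLinearMap.inCoordinates, continuousLinearMapAt_eq_chartDeriv hz,
    symmL_eq_chartInv hz]
  rfl

theorem contDiffAt_localMetric (g : PseudoRiemannianMetric E M) (x : M) :
    ContDiffAt ℝ ∞ (localMetric g x) (extChartAt 𝓘(ℝ, E) x x) := by
  have h := (contMDiffAt_hom_bundle _).1 (g.smooth x)
  refine (contDiffAt_comp_symm.1 h.2).congr_of_eventuallyEq ?_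
  filter_upwards [eventually_mem_target x] with z hz
  have hz' := (extChartAt 𝓘(ℝ, E) x).map_target hz
  rw [extChartAt_source] at hz'
  ext v w
  have hb : (extChartAt 𝓘(ℝ, E) x).symm z
      ∈ (trivializationAt E (TangentSpace 𝓘(ℝ, E)) x).baseSet := by simpa using hz'
  rw [Function.comp_apply, inCoordinates_apply_eq₂ hb hb (by simp), localMetric_apply,
    ← symmL_eq_chartInv hz, Trivialization.symmL_apply _ hb, Trivialization.symmL_apply _ hb]
  simp

theorem contDiffAt_localField {Y : ∀ y : M, TangentSpace 𝓘(ℝ, E) y} {x : M}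
    (hY : SmoothFieldAt Y x) :
    ContDiffAt ℝ ∞ (localField Y x) (extChartAt 𝓘(ℝ, E) x x) := by
  have h := (contMDiffAt_totalSpace.1 hY).2
  refine (contDiffAt_comp_symm.1 h).congr_of_eventuallyEq ?_
  filter_upwards [eventually_mem_target x] with z hz
  have hz' := (extChartAt 𝓘(ℝ, E) x).map_target hz
  rw [extChartAt_source] at hz'
  have hb : (extChartAt 𝓘(ℝ, E) x).symm z
      ∈ (trivializationAt E (TangentSpace 𝓘(ℝ, E)) x).baseSet := by simpa using hz'
  rw [localField, ← continuousLinearMapAt_eq_chartDeriv hz,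
    Trivialization.continuousLinearMapAt_apply_of_mem (R := ℝ) _ hb]
  rfl

/-- The vector field with constant coefficients `v` in the chart at `x`. -/
def constField (x : M) (v : E) (y : M) : TangentSpace 𝓘(ℝ, E) y :=
  (trivializationAt E (TangentSpace 𝓘(ℝ, E)) x).symmL ℝ y v

theorem smoothFieldAt_constField (x : M) (v : E) : SmoothFieldAt (constField x v) x := by
  refine (contMDiffAt_section (F := E) (s := constField x v) x).2 ?_
  refine (contMDiffAt_const (c := v)).congr_of_eventuallyEq ?_
  filter_upwards [(trivializationAt E (TangentSpace 𝓘(ℝ, E)) x).open_baseSet.mem_nhds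
    (mem_baseSet_trivializationAt E (TangentSpace 𝓘(ℝ, E)) x)] with y hy
  have h := (trivializationAt E (TangentSpace 𝓘(ℝ, E)) x).continuousLinearMapAt_symmL (R := ℝ) hy v
  rwa [Trivialization.continuousLinearMapAt_apply_of_mem (R := ℝ) _ hy] at h

theorem localField_constField {x : M} {z : E} (hz : z ∈ (extChartAt 𝓘(ℝ, E) x).target) (v : E) :
    localField (constField x v) x z = v := by
  rw [localField, constField, symmL_eq_chartInv hz, chartDeriv_chartInv hz]

theorem localField_toFun (J : ComplexStructure E M) (Y : ∀ y : M, TangentSpace 𝓘(ℝ, E) y) {x : M}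
    {z : E} (hz : z ∈ (extChartAt 𝓘(ℝ, E) x).target) :
    localField (fun y => J.toFun y (Y y)) x z = localEnd J x z (localField Y x z) := by
  rw [localField, localField, localEnd_apply, chartInv_chartDeriv hz]

/-- Pulling back by the inverse chart is applying the derivative of the chart, and at the centre of
the chart that derivative is the identity of the model space. -/
theorem mlieBracket_eq_lieBracket (V W : ∀ y : M, TangentSpace 𝓘(ℝ, E) y) (x : M) :
    mlieBracket 𝓘(ℝ, E) V W x
      = lieBracket ℝ (localField V x) (localField W x) (extChartAt 𝓘(ℝ, E) x x) := by
  have := isManifold_one E M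
  have key : ∀ V : ∀ y : M, TangentSpace 𝓘(ℝ, E) y,
      mpullback 𝓘(ℝ, E) 𝓘(ℝ, E) (extChartAt 𝓘(ℝ, E) x).symm V
        =ᶠ[𝓝 (extChartAt 𝓘(ℝ, E) x x)] localField V x := by
    intro V
    filter_upwards [eventually_mem_target x] with z hz
    rw [mpullback_apply]
    have h := ContinuousLinearMap.inverse_eq (f := chartInv x z) (g := chartDeriv x z)
      (by ext v; exact chartInv_chartDeriv hz v) (by ext v; exact chartDeriv_chartInv hz v)
    exact congr($h _)
  rw [← mlieBracketWithin_univ, mlieBracketWithin_apply, mfderiv_extChartAt_self]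
  simp only [ModelWithCorners.range_eq_univ, mpullbackWithin_univ, Set.preimage_univ,
    Set.univ_inter]
  refine (DFunLike.congr_fun
    (ContinuousLinearMap.inverse_id : (ContinuousLinearMap.id ℝ E).inverse = .id ℝ E) _).trans ?_
  refine Eq.trans ?_ (Filter.EventuallyEq.lieBracket_vectorField_eq (key V) (key W))
  exact congrFun (lieBracketWithin_univ (𝕜 := ℝ) (E := E)) _

theorem localEnd_self (J : ComplexStructure E M) (x : M) :
    localEnd J x (extChartAt 𝓘(ℝ, E) x x) = J.toFun x := by
  have := isManifold_one E M
  -- The base point is generalized because the tangent spaces at `x` and at the image of `x` under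
  -- the chart and back are indexed by points that are only propositionally equal.
  have key : ∀ y (hy : y = x) (v : E), (mfderiv 𝓘(ℝ, E) 𝓘(ℝ, E) (extChartAt 𝓘(ℝ, E) x) y)
      (J.toFun y v) = J.toFun x v := by
    rintro y rfl v
    rw [mfderiv_extChartAt_self]
    rfl
  have h₀ : ∀ v, chartInv x (extChartAt 𝓘(ℝ, E) x x) v = v := by
    intro v
    have h := mfderivWithin_range_extChartAt_symm (I := 𝓘(ℝ, E)) (x := x)
    rw [ModelWithCorners.range_eq_univ, mfderivWithin_univ] at h
    exact congr($h v)
  ext v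
  rw [localEnd_apply, h₀]
  exact key _ (extChartAt_to_inv x) v

end Chart

/-! ### The bivector at a point: naturality, type and real values -/

section LinearAlgebra

variable {E : Type*} [NormedAddCommGroup E] [NormedSpace ℝ E]

theorem isInvertible_of_nondegenerate [FiniteDimensional ℝ E] {g : E →L[ℝ] E →L[ℝ] ℝ}
    (hg : ∀ v, (∀ w, g v w = 0) → v = 0) : g.IsInvertible := by
  have hinj : Function.Injective (g : E →ₗ[ℝ] E →L[ℝ] ℝ) := by
    refine (injective_iff_map_eq_zero _).2 fun v hv => hg v fun w => ?_
    exact congr($hv w)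
  have hdim : Module.finrank ℝ E = Module.finrank ℝ (E →L[ℝ] ℝ) := by
    rw [← (LinearMap.toContinuousLinearMap (𝕜 := ℝ) (E := E) (F' := ℝ)).finrank_eq]
    exact Subspace.dual_finrank_eq.symm
  exact ⟨(LinearEquiv.ofInjectiveOfFinrankEq (g : E →ₗ[ℝ] E →L[ℝ] ℝ) hinj
    hdim).toContinuousLinearEquiv, by ext; rfl⟩

/-- The bivector `bivec s J S` as an alternating form on complex covectors. -/
def bivecAlternating (s : (E →L[ℝ] ℝ) →L[ℝ] E) (J S : E →L[ℝ] E)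
    (h : ∀ α, bivec s J S α α = 0) : (E →L[ℝ] ℂ) [⋀^Fin 2]→ₗ[ℂ] ℂ where
  toFun v := bivec s J S (v 0) (v 1)
  map_update_add' v i a b := by
    fin_cases i <;> simp [Function.update, bivec_add_left, bivec_add_right]
  map_update_smul' v i c a := by
    fin_cases i <;> simp [Function.update, bivec_smul_left, bivec_smul_right]
  map_eq_zero_of_eq' v i j hij hne := by
    have h01 : v 0 = v 1 := by
      fin_cases i <;> fin_cases j <;> simp_all
    rw [h01, h]

variable {s s' : (E →L[ℝ] ℝ) →L[ℝ] E} {J S e e' : E →L[ℝ] E}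

/-- Naturality of the construction under a change of coordinates `e`; it transports the bivector to
a chart. -/
theorem bivec_conj (he : ∀ v, e (e' v) = v) (hs : ∀ a, s' a = e' (s (a.comp e')))
    (α β : E →L[ℝ] ℂ) :
    bivec s' (e'.comp (J.comp e)) (e'.comp (S.comp e)) (α.comp e) (β.comp e)
      = bivec s J S α β := by
  have h₁ : ∀ w β : E →L[ℝ] ℂ, pairing s' (w.comp e) (β.comp e) = pairing s w β := by
    intro w β
    have h₂ : ∀ u : ℂ →L[ℝ] ℝ, (u.comp (w.comp e)).comp e' = u.comp w := by
      intro u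
      ext v
      simp [he]
    simp only [pairing, ContinuousLinearMap.comp_apply, hs, he, h₂]
  rw [bivec_eq_pairing, bivec_eq_pairing, ← h₁]
  congr 1
  ext v
  simp [he]

theorem bivec_eq_zero (h : J.comp S - S.comp J = 0) (α β : E →L[ℝ] ℂ) : bivec s J S α β = 0 := by
  have h₁ : -α.comp (0 : E →L[ℝ] E) - Complex.I • α.comp ((0 : E →L[ℝ] E).comp J) = 0 := by
    ext v
    simp
  rw [bivec_eq_pairing, h, h₁]
  simp [pairing]

/-- `AJ = -JA = -iA`, and composing a covector with `J` represents `-J`. -/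
theorem bivec_comp_left (hJ : ∀ v, J (J v) = -v) (α β : E →L[ℝ] ℂ) :
    bivec s J S (α.comp J) β = Complex.I * bivec s J S α β := by
  rw [bivec_eq_pairing, bivec_eq_pairing, ← pairing_smul_left]
  congr 1
  ext v
  simp [hJ]
  linear_combination (α (J (S (J v))) + α (S v)) * Complex.I_mul_I

theorem bivec_cflat {g : E →L[ℝ] E →L[ℝ] ℝ} (hsg : ∀ v, s (g v) = v)
    (hJ : ∀ v w, g (J v) w = -g v (J w)) (hS : ∀ v w, g (S v) w = -g v (S w)) (v w : E) :
    bivec s J S (cflat g v) (cflat g w) = (g w ((J.comp S - S.comp J) v) : ℂ)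
        - Complex.I * (g w (J ((J.comp S - S.comp J) v)) : ℂ) := by
  have h : poissonEnd (coAct J) (coAct S) (cflat g v) = cflat g ((J.comp S - S.comp J) v)
      - Complex.I • cflat g (J ((J.comp S - S.comp J) v)) := by
    simp only [poissonEnd, LinearMap.sub_apply, LinearMap.smul_apply, LinearMap.comp_apply,
      coAct_cflat hJ, coAct_cflat hS, map_sub]
    ext u
    simp [cflat]
  rw [bivec, h, sub_eq_add_neg, pairing_add_left, pairing_neg_left, pairing_smul_left,
    pairing_cflat_left hsg, pairing_cflat_left hsg]
  simp [cflat, sub_eq_add_neg]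

end LinearAlgebra

/-! ### The bivector field on the manifold and its bracket in charts -/

section GlobalBivector

open Filter Topology

set_option maxSynthPendingDepth 3

variable {E : Type*} [NormedAddCommGroup E] [NormedSpace ℝ E] {M : Type*} [TopologicalSpace M]
  [ChartedSpace E M] [IsManifold 𝓘(ℝ, E) ∞ M]

/-- The metric at a point, as a bilinear form on the model space. -/
def modelMetric (g : PseudoRiemannianMetric E M) (x : M) : E →L[ℝ] E →L[ℝ] ℝ := g.val x

/-- The value of an endomorphism field at a point, as an endomorphism of the model space. -/
def modelEnd (J : ComplexStructure E M) (x : M) : E →L[ℝ] E := J.toFun x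

/-- The inverse of the metric at a point, as a map from covectors to vectors. -/
def metricInv (g : PseudoRiemannianMetric E M) (x : M) : (E →L[ℝ] ℝ) →L[ℝ] E :=
  (modelMetric g x).inverse

/-- The inverse of the metric, read in the chart at `x`. -/
def localInv (g : PseudoRiemannianMetric E M) (x : M) (z : E) : (E →L[ℝ] ℝ) →L[ℝ] E :=
  (localMetric g x z).inverse

theorem Compatible.skew {g : PseudoRiemannianMetric E M} {J : ComplexStructure E M}
    (h : Compatible g J) (x : M) (v w : TangentSpace 𝓘(ℝ, E) x) :
    g.val x (J.toFun x v) w = -g.val x v (J.toFun x w) := by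
  rw [← h x (J.toFun x v) w, J.sq]
  simp

section FiniteDimensional

variable [FiniteDimensional ℝ E] (g : PseudoRiemannianMetric E M)

theorem isInvertible_metric (x : M) : (modelMetric g x).IsInvertible :=
  isInvertible_of_nondegenerate (g.nondegenerate x)

theorem metricInv_modelMetric (x : M) (v : E) : metricInv g x (modelMetric g x v) = v :=
  (isInvertible_metric g x).inverse_apply_self v

theorem modelMetric_metricInv (x : M) (a : E →L[ℝ] ℝ) : modelMetric g x (metricInv g x a) = a :=
  (isInvertible_metric g x).self_apply_inverse a

theorem isInvertible_localMetric {x : M} {z : E} (hz : z ∈ (extChartAt 𝓘(ℝ, E) x).target) :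
    (localMetric g x z).IsInvertible := by
  refine isInvertible_of_nondegenerate fun v hv => ?_
  rw [← chartDeriv_chartInv hz v, g.nondegenerate _ (chartInv x z v), map_zero]
  intro w
  rw [← chartInv_chartDeriv hz w, ← localMetric_apply, hv]

theorem localInv_apply {x : M} {z : E} (hz : z ∈ (extChartAt 𝓘(ℝ, E) x).target)
    (a : E →L[ℝ] ℝ) :
    localInv g x z a
      = chartDeriv x z (metricInv g ((extChartAt 𝓘(ℝ, E) x).symm z)
        (a.comp (chartDeriv x z))) := by
  rw [localInv, (isInvertible_localMetric g hz).inverse_apply_eq]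
  ext w
  set p := metricInv g ((extChartAt 𝓘(ℝ, E) x).symm z) (a.comp (chartDeriv x z))
  have h₁ : a w = modelMetric g ((extChartAt 𝓘(ℝ, E) x).symm z) p (chartInv x z w) := by
    rw [modelMetric_metricInv]
    exact congr(a $(chartDeriv_chartInv hz w)).symm
  rw [h₁, localMetric_apply]
  exact congr(g.val _ $(chartInv_chartDeriv hz p) (chartInv x z w)).symm

theorem contDiffAt_localInv (x : M) :
    ContDiffAt ℝ ∞ (localInv g x) (extChartAt 𝓘(ℝ, E) x x) :=
  (isInvertible_localMetric g (mem_extChartAt_target x)).contDiffAt_map_inverse.comp _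
    (contDiffAt_localMetric g x)

variable {g} {Jp Jm : ComplexStructure E M} (hp : Compatible g Jp) (hm : Compatible g Jm)

/-- The complex bivector field determined by the endomorphisms `[J₁, J₂] - i J₁[J₁, J₂]`. -/
def poissonBivector : BivectorField E M := fun x =>
  bivecAlternating (E := E) (metricInv g x) (modelEnd Jp x) (modelEnd Jm x) fun α => by
    have h := bivec_antisymm (E := E) (modelMetric_metricInv g x) (metricInv_modelMetric g x) (g.symm x) (Jp.sq x)
      (hp.skew x) (hm.skew x) α α
    exact self_eq_neg.1 h

theorem poissonBivector_isDeterminedBy : IsDeterminedBy g Jp Jm (poissonBivector hp hm) := by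
  intro x v w
  rw [g.symm x (commutator Jp Jm x v), g.symm x (Jp.toFun x (commutator Jp Jm x v))]
  exact bivec_cflat (E := E) (metricInv_modelMetric g x) (hp.skew x) (hm.skew x) v w

theorem poissonBivector_isTypeTwoZero : IsTypeTwoZero Jp (poissonBivector hp hm) :=
  fun x α β => bivec_comp_left (E := E) (Jp.sq x) α β

theorem poissonBivector_eq_zero_iff (x : M) :
    poissonBivector hp hm x = 0 ↔ commutator Jp Jm x = 0 := by
  constructor
  · intro h
    ext v
    refine g.nondegenerate x _ fun w => ?_
    have h₁ := poissonBivector_isDeterminedBy hp hm x v w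
    rw [h] at h₁
    simpa using congr(Complex.re $h₁.symm)
  · intro h
    ext v
    exact bivec_eq_zero (J := modelEnd Jp x) (S := modelEnd Jm x) h _ _

variable {f h : M → ℂ} {x : M}

omit [FiniteDimensional ℝ E] in
theorem mvfderiv_comp_chartInv {z : E} (hz : z ∈ (extChartAt 𝓘(ℝ, E) x).target)
    (hf : MDifferentiableAt 𝓘(ℝ, E) 𝓘(ℝ, ℂ) f ((extChartAt 𝓘(ℝ, E) x).symm z)) :
    fderiv ℝ (f ∘ (extChartAt 𝓘(ℝ, E) x).symm) z
      = (mvfderiv 𝓘(ℝ, E) f ((extChartAt 𝓘(ℝ, E) x).symm z)).comp (chartInv x z) := by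
  have := isManifold_one E M
  have hφ : MDifferentiableAt 𝓘(ℝ, E) 𝓘(ℝ, E) (extChartAt 𝓘(ℝ, E) x).symm z := by
    have := mdifferentiableWithinAt_extChartAt_symm (I := 𝓘(ℝ, E)) hz
    rwa [ModelWithCorners.range_eq_univ, mdifferentiableWithinAt_univ] at this
  rw [← mfderiv_eq_fderiv, mfderiv_comp z hf hφ]
  rfl

omit [FiniteDimensional ℝ E] in
theorem eventually_mdifferentiableAt (hf : SmoothFunAt E f x) :
    ∀ᶠ z in 𝓝 (extChartAt 𝓘(ℝ, E) x x),
      MDifferentiableAt 𝓘(ℝ, E) 𝓘(ℝ, ℂ) f ((extChartAt 𝓘(ℝ, E) x).symm z) := by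
  have := isManifold_one E M
  have h₁ : ∀ᶠ y in 𝓝 x, MDifferentiableAt 𝓘(ℝ, E) 𝓘(ℝ, ℂ) f y := by
    -- Being `C^n` at a point extends to a neighbourhood for finite `n`, so `∞` is lowered to `1`.
    filter_upwards [(contMDiffAt_iff_contMDiffAt_nhds (by simp)).1
      (ContMDiffAt.of_le hf (m := 1) (by simp))] with y hy
    exact hy.mdifferentiableAt (by simp)
  have h₂ := continuousAt_extChartAt_symm (I := 𝓘(ℝ, E)) x
  rw [ContinuousAt, extChartAt_to_inv] at h₂
  exact h₂.eventually h₁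

theorem bracket_comp_symm {z : E} (hz : z ∈ (extChartAt 𝓘(ℝ, E) x).target)
    (hf : MDifferentiableAt 𝓘(ℝ, E) 𝓘(ℝ, ℂ) f ((extChartAt 𝓘(ℝ, E) x).symm z))
    (hh : MDifferentiableAt 𝓘(ℝ, E) 𝓘(ℝ, ℂ) h ((extChartAt 𝓘(ℝ, E) x).symm z)) :
    bracket (poissonBivector hp hm) f h ((extChartAt 𝓘(ℝ, E) x).symm z)
      = localBracket (localInv g x) (localEnd Jp x) (localEnd Jm x)
        (f ∘ (extChartAt 𝓘(ℝ, E) x).symm) (h ∘ (extChartAt 𝓘(ℝ, E) x).symm) z := by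
  rw [localBracket, mvfderiv_comp_chartInv hz hf, mvfderiv_comp_chartInv hz hh]
  exact (bivec_conj (E := E) (chartInv_chartDeriv hz) (localInv_apply g hz) _ _).symm

/-- Agreement of germs, not merely of values, is needed because the bracket is differentiated again
in the Jacobi identity and in `∂̄P`. -/
theorem eventuallyEq_bracket (hf : SmoothFunAt E f x) (hh : SmoothFunAt E h x) :
    bracket (poissonBivector hp hm) f h ∘ (extChartAt 𝓘(ℝ, E) x).symm
      =ᶠ[𝓝 (extChartAt 𝓘(ℝ, E) x x)]
      localBracket (localInv g x) (localEnd Jp x) (localEnd Jm x)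
        (f ∘ (extChartAt 𝓘(ℝ, E) x).symm) (h ∘ (extChartAt 𝓘(ℝ, E) x).symm) := by
  filter_upwards [eventually_mem_target x, eventually_mdifferentiableAt hf,
    eventually_mdifferentiableAt hh] with z hz hfz hhz
  exact bracket_comp_symm hp hm hz hfz hhz

omit [FiniteDimensional ℝ E] in
theorem derivZeroOne_comp_symm (J : ComplexStructure E M)
    (Y : ∀ y : M, TangentSpace 𝓘(ℝ, E) y) {z : E} (hz : z ∈ (extChartAt 𝓘(ℝ, E) x).target)
    (hf : MDifferentiableAt 𝓘(ℝ, E) 𝓘(ℝ, ℂ) f ((extChartAt 𝓘(ℝ, E) x).symm z)) :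
    derivZeroOne J Y f ((extChartAt 𝓘(ℝ, E) x).symm z)
      = localZeroOne (localEnd J x) (localField Y x) (f ∘ (extChartAt 𝓘(ℝ, E) x).symm) z := by
  rw [localZeroOne, mvfderiv_comp_chartInv hz hf, derivZeroOne]
  have h₁ := chartInv_chartDeriv hz (Y ((extChartAt 𝓘(ℝ, E) x).symm z))
  have h₂ := chartInv_chartDeriv hz (J.toFun ((extChartAt 𝓘(ℝ, E) x).symm z)
    (Y ((extChartAt 𝓘(ℝ, E) x).symm z)))
  simp only [ContinuousLinearMap.comp_apply, localEnd_apply, localField, h₁, h₂]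

omit [FiniteDimensional ℝ E] in
theorem eventuallyEq_derivZeroOne (J : ComplexStructure E M)
    (Y : ∀ y : M, TangentSpace 𝓘(ℝ, E) y) (hf : SmoothFunAt E f x) :
    derivZeroOne J Y f ∘ (extChartAt 𝓘(ℝ, E) x).symm =ᶠ[𝓝 (extChartAt 𝓘(ℝ, E) x x)]
      localZeroOne (localEnd J x) (localField Y x) (f ∘ (extChartAt 𝓘(ℝ, E) x).symm) := by
  filter_upwards [eventually_mem_target x, eventually_mdifferentiableAt hf] with z hz hfz
  exact derivZeroOne_comp_symm J Y hz hfz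

end FiniteDimensional

end GlobalBivector

/-! ### The differential of a Kähler form in coordinates -/

section ExteriorDerivative

open Filter Topology

set_option maxSynthPendingDepth 3

variable {E : Type*} [NormedAddCommGroup E] [NormedSpace ℝ E]

/-- The skew symmetrization `(v, w) ↦ (B(v, w) - B(w, v)) / 2` of a bilinear form. -/
def skewForm : (E →L[ℝ] E →L[ℝ] ℝ) →ₗ[ℝ] E [⋀^Fin 2]→L[ℝ] ℝ where
  toFun B :=
    { toFun := fun v => (B (v 0) (v 1) - B (v 1) (v 0)) / 2
      map_update_add' := fun v i a b => by
        fin_cases i <;> simp [Function.update] <;> ring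
      map_update_smul' := fun v i c a => by
        fin_cases i <;> simp [Function.update] <;> ring
      cont := by fun_prop
      map_eq_zero_of_eq' := fun v i j hij hne => by
        have h01 : v 0 = v 1 := by
          fin_cases i <;> fin_cases j <;> simp_all
        simp [h01] }
  map_add' B B' := by
    ext v
    change ((B + B') (v 0) (v 1) - (B + B') (v 1) (v 0)) / 2
      = (B (v 0) (v 1) - B (v 1) (v 0)) / 2 + (B' (v 0) (v 1) - B' (v 1) (v 0)) / 2
    simp only [_root_.add_apply]
    ring
  map_smul' c B := by
    ext v
    change ((c • B) (v 0) (v 1) - (c • B) (v 1) (v 0)) / 2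
      = c * ((B (v 0) (v 1) - B (v 1) (v 0)) / 2)
    simp only [_root_.smul_apply, smul_eq_mul]
    ring

theorem skewForm_apply (B : E →L[ℝ] E →L[ℝ] ℝ) (v : Fin 2 → E) :
    skewForm B v = (B (v 0) (v 1) - B (v 1) (v 0)) / 2 := rfl

theorem fderiv_apply_apply {g : E → E →L[ℝ] E →L[ℝ] ℝ} {J : E → E →L[ℝ] E} {z : E}
    (hg : DifferentiableAt ℝ g z) (hJ : DifferentiableAt ℝ J z) (X Y Z : E) :
    fderiv ℝ (fun y => g y (J y Y) Z) z X = kahlerDeriv g J z X Y Z := by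
  have h₁ := hJ.hasFDerivAt.clm_apply (hasFDerivAt_const Y z)
  have h₂ := (hg.hasFDerivAt.clm_apply h₁).clm_apply (hasFDerivAt_const Z z)
  rw [h₂.fderiv]
  simp [kahlerDeriv, add_comm]

theorem kahlerDeriv_skew {g : E → E →L[ℝ] E →L[ℝ] ℝ} {J : E → E →L[ℝ] E} {z : E}
    (hg : DifferentiableAt ℝ g z) (hJ : DifferentiableAt ℝ J z)
    (h : ∀ᶠ y in 𝓝 z, ∀ v w, g y (J y v) w = -g y (J y w) v) (X Y Z : E) :
    kahlerDeriv g J z X Y Z = -kahlerDeriv g J z X Z Y := by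
  rw [← fderiv_apply_apply hg hJ, ← fderiv_apply_apply hg hJ]
  have : (fun y => g y (J y Y) Z) =ᶠ[𝓝 z] fun y => -g y (J y Z) Y := by
    filter_upwards [h] with y hy
    exact hy Y Z
  rw [this.fderiv_eq, fderiv_fun_neg]
  rfl

theorem extDeriv_eq_kahlerDeriv [FiniteDimensional ℝ E] {g : E → E →L[ℝ] E →L[ℝ] ℝ}
    {J : E → E →L[ℝ] E} {z : E} (hg : DifferentiableAt ℝ g z) (hJ : DifferentiableAt ℝ J z)
    (h : ∀ᶠ y in 𝓝 z, ∀ v w, g y (J y v) w = -g y (J y w) v) {η : E → E [⋀^Fin 2]→L[ℝ] ℝ}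
    (hη : ∀ᶠ y in 𝓝 z, ∀ v, η y v = g y (J y (v 0)) (v 1)) (X Y Z : E) :
    extDeriv η z ![X, Y, Z]
      = kahlerDeriv g J z X Y Z + kahlerDeriv g J z Y Z X + kahlerDeriv g J z Z X Y := by
  -- `η` is known only through its values. Writing it as a fixed linear map, continuous in finite
  -- dimension, applied to `g ∘ J` yields differentiability as a map into alternating forms.
  have h₁ : η =ᶠ[𝓝 z] fun y => skewForm ((g y).comp (J y)) := by
    filter_upwards [h, hη] with y hy hy'
    ext v
    rw [hy', skewForm_apply, ContinuousLinearMap.comp_apply, ContinuousLinearMap.comp_apply,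
      hy (v 1)]
    ring
  have h₂ : DifferentiableAt ℝ η z := by
    refine DifferentiableAt.congr_of_eventuallyEq ?_ h₁
    exact (LinearMap.toContinuousLinearMap skewForm).differentiableAt.comp z (hg.clm_comp hJ)
  have h₃ : ∀ X (v : Fin 2 → E), fderiv ℝ η z X v = kahlerDeriv g J z X (v 0) (v 1) := by
    intro X v
    rw [← fderiv_apply_apply hg hJ]
    have h₄ : (fun y => g y (J y (v 0)) (v 1)) =ᶠ[𝓝 z] fun y => η y v := by
      filter_upwards [hη] with y hy
      exact (hy v).symm
    rw [h₄.fderiv_eq]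
    have h₅ := (ContinuousAlternatingMap.apply ℝ E ℝ v).hasFDerivAt.comp z h₂.hasFDerivAt
    exact congr($(h₅.fderiv) X).symm
  rw [extDeriv, ContinuousAlternatingMap.alternatizeUncurryFin_apply, Fin.sum_univ_three]
  simp only [h₃]
  -- The alternating sum has the middle term with a minus sign; skewness in the last two arguments
  -- makes it cyclic.
  rw [show kahlerDeriv g J z Y Z X = -kahlerDeriv g J z Y X Z from kahlerDeriv_skew hg hJ h _ _ _]
  simp [Fin.removeNth, Fin.succAbove]

end ExteriorDerivative

/-! ### Transfer of the local results to the manifold -/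

section Globalization

open Filter Topology

set_option maxSynthPendingDepth 3

variable {E : Type*} [NormedAddCommGroup E] [NormedSpace ℝ E] {M : Type*} [TopologicalSpace M]
  [ChartedSpace E M] [IsManifold 𝓘(ℝ, E) ∞ M]

theorem localEnd_localEnd (J : ComplexStructure E M) {x : M} {z : E}
    (hz : z ∈ (extChartAt 𝓘(ℝ, E) x).target) (v : E) : localEnd J x z (localEnd J x z v) = -v := by
  rw [localEnd_apply, localEnd_apply, chartInv_chartDeriv hz, J.sq, map_neg,
    chartDeriv_chartInv hz]

theorem localMetric_symm (g : PseudoRiemannianMetric E M) (x : M) (z v w : E) :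
    localMetric g x z v w = localMetric g x z w v :=
  g.symm ((extChartAt 𝓘(ℝ, E) x).symm z) (chartInv x z v) (chartInv x z w)

theorem localMetric_localEnd {g : PseudoRiemannianMetric E M} {J : ComplexStructure E M}
    (h : Compatible g J) {x : M} {z : E} (hz : z ∈ (extChartAt 𝓘(ℝ, E) x).target) (v w : E) :
    localMetric g x z (localEnd J x z v) (localEnd J x z w) = localMetric g x z v w := by
  rw [localMetric_apply, localMetric_apply, localEnd_apply, localEnd_apply,
    chartInv_chartDeriv hz, chartInv_chartDeriv hz, h]

/-- The Nijenhuis tensor is evaluated on fields with constant coefficients in the chart. Their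
mutual bracket vanishes, and the other three brackets involve only first derivatives of `J`. -/
theorem localEnd_nijenhuis [CompleteSpace E] (J : ComplexStructure E M) (x : M) (u v : E) :
    fderiv ℝ (localEnd J x) (extChartAt 𝓘(ℝ, E) x x)
        (localEnd J x (extChartAt 𝓘(ℝ, E) x x) u) v
      - fderiv ℝ (localEnd J x) (extChartAt 𝓘(ℝ, E) x x)
        (localEnd J x (extChartAt 𝓘(ℝ, E) x x) v) u
      + localEnd J x (extChartAt 𝓘(ℝ, E) x x)
        (fderiv ℝ (localEnd J x) (extChartAt 𝓘(ℝ, E) x x) v u)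
      - localEnd J x (extChartAt 𝓘(ℝ, E) x x)
        (fderiv ℝ (localEnd J x) (extChartAt 𝓘(ℝ, E) x x) u v) = 0 := by
  have hc : ∀ v : E, localField (constField x v) x =ᶠ[𝓝 (extChartAt 𝓘(ℝ, E) x x)] fun _ => v :=
    fun v => by
      filter_upwards [eventually_mem_target x] with z hz
      exact localField_constField hz v
  have hJ : ∀ v : E, localField (fun y => J.toFun y (constField x v y)) x
      =ᶠ[𝓝 (extChartAt 𝓘(ℝ, E) x x)] fun z => localEnd J x z v := fun v => by
    filter_upwards [eventually_mem_target x] with z hz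
    rw [localField_toFun J _ hz, localField_constField hz]
  have hd : ∀ u v : E, fderiv ℝ (fun z => localEnd J x z v) (extChartAt 𝓘(ℝ, E) x x) u
      = fderiv ℝ (localEnd J x) (extChartAt 𝓘(ℝ, E) x x) u v := fun u v => by
    have h := ((contDiffAt_localEnd J x).differentiableAt (by simp)).hasFDerivAt.clm_apply
      (hasFDerivAt_const v (extChartAt 𝓘(ℝ, E) x x))
    rw [h.fderiv]
    simp
  have h := J.integrable x (constField x u) (constField x v) (smoothFieldAt_constField x u)
    (smoothFieldAt_constField x v)
  rw [← localEnd_self] at h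
  simp only [mlieBracket_eq_lieBracket] at h
  rw [(hJ u).lieBracket_vectorField_eq (hJ v), (hJ u).lieBracket_vectorField_eq (hc v),
    (hc u).lieBracket_vectorField_eq (hJ v), (hc u).lieBracket_vectorField_eq (hc v)] at h
  simp only [lieBracket_eq, hd, fderiv_fun_const, Pi.zero_apply, zero_apply, sub_zero, zero_sub]
    at h
  have key : ∀ (L : E →L[ℝ] E) (a b c d : E), a - b - L (-c) - L d - 0 = 0 →
      a - b + L c - L d = 0 := fun L a b c d h => by simpa using h
  exact key _ _ _ _ _ h

theorem isHermitianGerm [CompleteSpace E] {g : PseudoRiemannianMetric E M}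
    {J : ComplexStructure E M} (h : Compatible g J) (x : M) :
    IsHermitianGerm (localMetric g x) (localEnd J x) (extChartAt 𝓘(ℝ, E) x x) where
  smooth_metric := contDiffAt_localMetric g x
  smooth := contDiffAt_localEnd J x
  symm := .of_forall fun z v w => localMetric_symm g x z v w
  sq := (eventually_mem_target x).mono fun _ hz => localEnd_localEnd J hz
  compat := (eventually_mem_target x).mono fun _ hz => localMetric_localEnd h hz
  nijenhuis := localEnd_nijenhuis J x

variable [FiniteDimensional ℝ E]

theorem dc_kahlerForm {g : PseudoRiemannianMetric E M} {J : ComplexStructure E M}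
    (h : Compatible g J) {x : M} {z : E} (hz : z = extChartAt 𝓘(ℝ, E) x x) (X Y Z : E) :
    dc J (kahlerForm g J h) x ![X, Y, Z]
      = -(kahlerDeriv (localMetric g x) (localEnd J x) z (localEnd J x z X) (localEnd J x z Y)
            (localEnd J x z Z)
          + kahlerDeriv (localMetric g x) (localEnd J x) z (localEnd J x z Y) (localEnd J x z Z)
            (localEnd J x z X)
          + kahlerDeriv (localMetric g x) (localEnd J x) z (localEnd J x z Z) (localEnd J x z X)
            (localEnd J x z Y)) := by
  subst hz
  have hφ : ∀ v : TangentSpace 𝓘(ℝ, E) x,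
      mfderiv 𝓘(ℝ, E) 𝓘(ℝ, E) (extChartAt 𝓘(ℝ, E) x) x v = v := fun v => by
    have := isManifold_one E M
    rw [mfderiv_extChartAt_self]
    rfl
  have H := isHermitianGerm h x
  have hη : ∀ᶠ y in 𝓝 (extChartAt 𝓘(ℝ, E) x x), ∀ v : Fin 2 → E,
      ((kahlerForm g J h ((extChartAt 𝓘(ℝ, E) x).symm y)).compContinuousLinearMap
        (J.toFun ((extChartAt 𝓘(ℝ, E) x).symm y))).compContinuousLinearMap
          (mfderiv 𝓘(ℝ, E) 𝓘(ℝ, E) (extChartAt 𝓘(ℝ, E) x).symm y) v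
        = localMetric g x y (localEnd J x y (v 0)) (v 1) := by
    filter_upwards [eventually_mem_target x] with y hy v
    -- `F` is of type `(1,1)`: the form `F(J·, J·)` that `dc` differentiates is `F` itself.
    rw [localMetric_apply, localEnd_apply, chartInv_chartDeriv hy, ← h]
    rfl
  have hskew : ∀ᶠ y in 𝓝 (extChartAt 𝓘(ℝ, E) x x), ∀ v w,
      localMetric g x y (localEnd J x y v) w = -localMetric g x y (localEnd J x y w) v := by
    filter_upwards [H.skew] with y hy v w
    rw [hy, localMetric_symm]
  have key := extDeriv_eq_kahlerDeriv (H.smooth_metric.differentiableAt (by simp))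
    (H.smooth.differentiableAt (by simp)) hskew hη
    (-localEnd J x (extChartAt 𝓘(ℝ, E) x x) X) (-localEnd J x (extChartAt 𝓘(ℝ, E) x x) Y)
    (-localEnd J x (extChartAt 𝓘(ℝ, E) x x) Z)
  simp only [kahlerDeriv, map_neg, neg_apply, neg_neg] at key ⊢
  refine Eq.trans ?_ (key.trans (by ring))
  refine congrArg (extDeriv _ _) (funext fun i => ?_)
  refine (hφ _).trans ?_
  rw [localEnd_self]
  fin_cases i <;> rfl

variable {g : PseudoRiemannianMetric E M} {Jp Jm : ComplexStructure E M}
  (hp : Compatible g Jp) (hm : Compatible g Jm)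
  (hd : ∀ x : M, dc Jp (kahlerForm g Jp hp) x = -dc Jm (kahlerForm g Jm hm) x)
include hd

theorem isBihermitianGerm (x : M) :
    IsBihermitianGerm (localMetric g x) (localInv g x) (localEnd Jp x) (localEnd Jm x)
      (extChartAt 𝓘(ℝ, E) x x) where
  fst := have := FiniteDimensional.complete ℝ E; isHermitianGerm hp x
  snd := have := FiniteDimensional.complete ℝ E; isHermitianGerm hm x
  smooth_inv := contDiffAt_localInv g x
  left_inv := (eventually_mem_target x).mono fun z hz =>
    (isInvertible_localMetric g hz).inverse_apply_self
  right_inv := (eventually_mem_target x).mono fun z hz =>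
    (isInvertible_localMetric g hz).self_apply_inverse
  dc_eq X Y Z := by
    have h : dc Jp (kahlerForm g Jp hp) x ![X, Y, Z] = -dc Jm (kahlerForm g Jm hm) x ![X, Y, Z] :=
      congr($(hd x) ![X, Y, Z])
    rw [dc_kahlerForm hp rfl, dc_kahlerForm hm rfl] at h
    linarith

theorem poissonBivector_isSmooth : IsSmooth (poissonBivector hp hm) := by
  intro x f h hf hh
  refine contDiffAt_comp_symm.2 ?_
  exact ((isBihermitianGerm hp hm hd x).contDiffAt_localBracket (contDiffAt_comp_symm.1 hf)
    (contDiffAt_comp_symm.1 hh)).congr_of_eventuallyEq (eventuallyEq_bracket hp hm hf hh)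

omit [IsManifold 𝓘(ℝ, E) ∞ M] [FiniteDimensional ℝ E] hd in
theorem SmoothFunAt.mdifferentiableAt_symm {f : M → ℂ} {x : M} (hf : SmoothFunAt E f x) :
    MDifferentiableAt 𝓘(ℝ, E) 𝓘(ℝ, ℂ) f
      ((extChartAt 𝓘(ℝ, E) x).symm (extChartAt 𝓘(ℝ, E) x x)) := by
  rw [extChartAt_to_inv]
  exact ContMDiffAt.mdifferentiableAt hf (by simp)

omit hd in
theorem bracket_eq_localBracket {f h : M → ℂ} {x : M} (hf : SmoothFunAt E f x)
    (hh : SmoothFunAt E h x) : bracket (poissonBivector hp hm) f h x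
      = localBracket (localInv g x) (localEnd Jp x) (localEnd Jm x)
        (f ∘ (extChartAt 𝓘(ℝ, E) x).symm) (h ∘ (extChartAt 𝓘(ℝ, E) x).symm)
        (extChartAt 𝓘(ℝ, E) x x) := by
  have := (eventuallyEq_bracket hp hm hf hh).self_of_nhds
  rwa [Function.comp_apply, extChartAt_to_inv] at this

/-- A nested bracket depends on the inner one only through its derivative, so the inner bracket may
be replaced by its chart expression, which has the same germ. -/
theorem poissonBivector_isPoisson : IsPoisson (poissonBivector hp hm) := by
  have key : ∀ (x : M) (f h k : M → ℂ), SmoothFunAt E f x → SmoothFunAt E h x →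
      SmoothFunAt E k x → bracket (poissonBivector hp hm) f (bracket (poissonBivector hp hm) h k) x
        = localBracket (localInv g x) (localEnd Jp x) (localEnd Jm x)
          (f ∘ (extChartAt 𝓘(ℝ, E) x).symm)
          (localBracket (localInv g x) (localEnd Jp x) (localEnd Jm x)
            (h ∘ (extChartAt 𝓘(ℝ, E) x).symm) (k ∘ (extChartAt 𝓘(ℝ, E) x).symm))
          (extChartAt 𝓘(ℝ, E) x x) := by
    intro x f h k hf hh hk
    rw [bracket_eq_localBracket hp hm hf (poissonBivector_isSmooth hp hm hd x h k hh hk),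
      localBracket, (eventuallyEq_bracket hp hm hh hk).fderiv_eq, localBracket]
  intro x f h k hf hh hk
  rw [key x f h k hf hh hk, key x h k f hh hk hf, key x k f h hk hf hh]
  exact (isBihermitianGerm hp hm hd x).jacobi (contDiffAt_comp_symm.1 hf)
    (contDiffAt_comp_symm.1 hh) (contDiffAt_comp_symm.1 hk)

omit [FiniteDimensional ℝ E] hd in
theorem smoothFunAt_derivZeroOne (J : ComplexStructure E M) {Y : ∀ y : M, TangentSpace 𝓘(ℝ, E) y}
    {f : M → ℂ} {x : M} (hY : SmoothFieldAt Y x) (hf : SmoothFunAt E f x) :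
    SmoothFunAt E (derivZeroOne J Y f) x := by
  refine contDiffAt_comp_symm.2 (ContDiffAt.congr_of_eventuallyEq ?_
    (eventuallyEq_derivZeroOne J Y hf))
  have hf' := (contDiffAt_comp_symm.1 hf).fderiv_right (m := ∞) (by simp)
  exact (hf'.clm_apply (contDiffAt_localField hY)).add (contDiffAt_const.mul
    (hf'.clm_apply ((contDiffAt_localEnd J x).clm_apply (contDiffAt_localField hY))))

omit [FiniteDimensional ℝ E] hd in
theorem fderiv_comp_localEnd {J : ComplexStructure E M} {f : M → ℂ} {x : M}
    (hf : SmoothFunAt E f x)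
    (h : (mvfderiv 𝓘(ℝ, E) f x).comp (J.toFun x) = Complex.I • mvfderiv 𝓘(ℝ, E) f x) :
    (fderiv ℝ (f ∘ (extChartAt 𝓘(ℝ, E) x).symm) (extChartAt 𝓘(ℝ, E) x x)).comp
        (localEnd J x (extChartAt 𝓘(ℝ, E) x x))
      = Complex.I • fderiv ℝ (f ∘ (extChartAt 𝓘(ℝ, E) x).symm) (extChartAt 𝓘(ℝ, E) x x) := by
  have hz := mem_extChartAt_target (I := 𝓘(ℝ, E)) x
  have h' : ∀ y, y = x → ∀ v, mvfderiv 𝓘(ℝ, E) f y (J.toFun y v)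
      = Complex.I * mvfderiv 𝓘(ℝ, E) f y v := by
    rintro y rfl v
    exact congr($h v)
  ext v
  rw [mvfderiv_comp_chartInv hz hf.mdifferentiableAt_symm]
  simp only [ContinuousLinearMap.comp_apply, localEnd_apply, chartInv_chartDeriv hz]
  exact h' _ (extChartAt_to_inv x) _

theorem poissonBivector_isHolomorphic : IsHolomorphic Jp (poissonBivector hp hm) := by
  refine ⟨poissonBivector_isSmooth hp hm hd, poissonBivector_isTypeTwoZero hp hm, ?_⟩
  intro x Y f h hY hf hh hf' hh'
  have hfh := poissonBivector_isSmooth hp hm hd x f h hf hh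
  -- Each of the three terms is moved to the chart, the inner function being replaced by a local one
  -- with the same germ.
  have h₁ := (eventuallyEq_derivZeroOne Jp Y hfh).self_of_nhds
  rw [Function.comp_apply, extChartAt_to_inv, localZeroOne,
    (eventuallyEq_bracket hp hm hf hh).fderiv_eq, ← localZeroOne] at h₁
  have h₂ := bracket_eq_localBracket hp hm (smoothFunAt_derivZeroOne Jp hY hf) hh
  have h₃ := bracket_eq_localBracket hp hm hf (smoothFunAt_derivZeroOne Jp hY hh)
  rw [localBracket, (eventuallyEq_derivZeroOne Jp Y hf).fderiv_eq, ← localBracket] at h₂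
  rw [localBracket, (eventuallyEq_derivZeroOne Jp Y hh).fderiv_eq, ← localBracket] at h₃
  rw [h₁, h₂, h₃]
  exact (isBihermitianGerm hp hm hd x).zeroOne (contDiffAt_comp_symm.1 hf)
    (contDiffAt_comp_symm.1 hh) ((contDiffAt_localField hY).differentiableAt (by simp))
    (fderiv_comp_localEnd hf hf') (fderiv_comp_localEnd hh hh')

end Globalization

end HolPoisson

end

theorem theorem3 {E : Type*} [NormedAddCommGroup E] [NormedSpace ℝ E] [FiniteDimensional ℝ E]
    {M : Type*} [TopologicalSpace M] [ChartedSpace E M] [IsManifold 𝓘(ℝ, E) ∞ M]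
    (g : HolPoisson.PseudoRiemannianMetric E M) (Jp Jm : HolPoisson.ComplexStructure E M)
    (hp : HolPoisson.Compatible g Jp) (hm : HolPoisson.Compatible g Jm)
    (hd : ∀ x : M, HolPoisson.dc Jp (HolPoisson.kahlerForm g Jp hp) x =
      -HolPoisson.dc Jm (HolPoisson.kahlerForm g Jm hm) x) :
    ∃ P : HolPoisson.BivectorField E M,
      HolPoisson.IsDeterminedBy g Jp Jm P ∧
      HolPoisson.IsHolomorphic Jp P ∧
      HolPoisson.IsPoisson P ∧
      ∀ x : M, P x = 0 ↔ HolPoisson.commutator Jp Jm x = 0 := by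
  exact ⟨HolPoisson.poissonBivector hp hm, HolPoisson.poissonBivector_isDeterminedBy hp hm,
    HolPoisson.poissonBivector_isHolomorphic hp hm hd,
    HolPoisson.poissonBivector_isPoisson hp hm hd, HolPoisson.poissonBivector_eq_zero_iff hp hm⟩
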